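/- **Theorem C (Quantization).** Let $X$ be a finite connected CW complex of dimension $d\ge 1$ with oriented cells, $X_k$ its set of $k$-cells, $C_*(X;A)$ its cellular chain complex with coefficients in a commutative ring $A$, with boundary operator $\partial$, and $\partial^*:C_{d-1}(X;\mathbb R)\to C_d(X;\mathbb R)$ the adjoint of $\partial$ for the inner products in which the cells are orthonormal. Let $z_0\in Z_{d-1}(X;\mathbb Z)$ be an integral cycle. Let $\gamma(t)=(E(t),W(t))$, with $E(t):X_{d-1}\to\mathbb R$ and $W(t):X_d\to\mathbb R$, be smooth and $1$-periodic in $t\in\mathbb R$, and assume that $\gamma$ is good: for every $t$, $E(t)$ or $W(t)$ is injective. For $\beta>0$ put $\partial^*_{E,W}=e^{-\beta W}\partial^*e^{\beta E}$ and $H=\partial\,\partial^*_{E,W}$, where $e^{\beta E}$ and $e^{-\beta W}$ act diagonally on the cells. For every $\beta>0$ there is $\tau_0>0$ such that for all $\tau_D>\tau_0$ the equation $\dot\rho=-\tau_D H(t)\rho$ has a unique $1$-periodic solution $\rho=\rho_{\tau_D,\beta}$ with values in the real homology class of $z_0$. The average current $$Q_{\tau_D,\beta}=\int_0^1\tau_D\,\partial^*_{E,W}\,\rho(t)\,dt$$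 is then a cycle, that is, an element of $Z_d(X;\mathbb R)=H_d(X;\mathbb R)$. The limit $Q^B_\beta=\lim_{\tau_D\to\infty}Q_{\tau_D,\beta}$ exists for every $\beta>0$, the limit $\lim_{\beta\to\infty}Q^B_\beta$ exists, and $$\lim_{\beta\to\infty}\lim_{\tau_D\to\infty}Q_{\tau_D,\beta}\in H_d(X;\mathbb Z[\tfrac1\delta])\subset H_d(X;\mathbb R),\qquad \delta=\prod_{L,T}a_L\,\theta_T,$$ where $\delta$ is a positive integer. Here $L$ ranges over the spanning co-trees of $X$: the subcomplexes $X^{(d-2)}\subset L\subset X^{(d-1)}$ for which $H_{d-1}(L;\mathbb Q)\to H_{d-1}(X;\mathbb Q)$ is an isomorphism and $\operatorname{rk}H_{d-2}(L;\mathbb Q)=\operatorname{rk}H_{d-2}(X;\mathbb Q)$; and $a_L$ is the order of $H_{d-1}(X,L;\mathbb Z)$. And $T$ ranges over the spanning trees: the subcomplexes $X^{(d-1)}\subset T\subset X$ with $H_d(T;\mathbb Z)=0$ and $\operatorname{rk}H_{d-1}(T;\mathbb Q)=\operatorname{rk}H_{d-1}(X;\mathbb Q)$; and $\theta_T$ is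 the order of the torsion subgroup of $H_{d-1}(T;\mathbb Z)$. -/

import Mathlib

open scoped Topology ContDiff
open Filter

universe u

noncomputable section

/-! ## Relative singular homology of a pair of subspaces -/

namespace Singular

open CategoryTheory AlgebraicTopology

/-- The singular chain complex of a space with integer coefficients. -/
abbrev chains (Y : Type u) [TopologicalSpace Y] : ChainComplex AddCommGrpCat.{u} ℕ :=
  ((singularChainComplexFunctor AddCommGrpCat.{u}).obj (AddCommGrpCat.of (ULift.{u} ℤ))).obj
    (TopCat.of Y)

/-- The chain map induced by a continuous map, in degree `k`. -/
def pushforward {Y Z : Type u} [TopologicalSpace Y] [TopologicalSpace Z] (f : C(Y, Z)) (k : ℕ) :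
    (chains Y).X k →+ (chains Z).X k :=
  ((((singularChainComplexFunctor AddCommGrpCat.{u}).obj
    (AddCommGrpCat.of (ULift.{u} ℤ))).map (TopCat.ofHom f)).f k).hom

variable (Y : Type u) [TopologicalSpace Y]

/-- The singular boundary operator. For `k = 0` the map `d Y k (k - 1)` is zero. -/
def d (i j : ℕ) : (chains Y).X i →+ (chains Y).X j := ((chains Y).d i j).hom

/-- The singular chains of `Y` that come from the subspace `P`. -/
def chainsOn (P : Set Y) (k : ℕ) : AddSubgroup ((chains Y).X k) :=
  (pushforward (⟨Subtype.val, continuous_subtype_val⟩ : C(P, Y)) k).range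

/-- Relative cycles of the pair `(P, A)`. -/
def cycles (P A : Set Y) (k : ℕ) : AddSubgroup ((chains Y).X k) :=
  chainsOn Y P k ⊓ (chainsOn Y A (k - 1)).comap (d Y k (k - 1))

/-- Relative boundaries of the pair `(P, A)`. -/
def boundaries (P A : Set Y) (k : ℕ) : AddSubgroup ((chains Y).X k) :=
  chainsOn Y A k ⊔ (chainsOn Y P (k + 1)).map (d Y (k + 1) k)

/-- The relative singular homology group `H_k(P, A; ℤ)` of subspaces `A ⊆ P` of `Y`. -/
abbrev Homology (P A : Set Y) (k : ℕ) : Type u :=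
  cycles Y P A k ⧸ (boundaries Y P A k).addSubgroupOf (cycles Y P A k)

/-- The homology class of a relative cycle. -/
abbrev homologyClass {P A : Set Y} {k : ℕ} (z : cycles Y P A k) : Homology Y P A k :=
  QuotientAddGroup.mk z

variable {Y}

theorem d_d (i j k : ℕ) (c : (chains Y).X i) : d Y j k (d Y i j c) = 0 := by
  have h := (chains Y).d_comp_d i j k
  exact congrArg (fun f => f.hom c) h

theorem d_mem_cycles {P A : Set Y} (A' : Set Y) {k : ℕ} (c : (chains Y).X (k + 1))
    (hc : c ∈ cycles Y P A (k + 1)) : d Y (k + 1) k c ∈ cycles Y A A' k := by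
  refine ⟨hc.2, ?_⟩
  change d Y k (k - 1) (d Y (k + 1) k c) ∈ chainsOn Y A' (k - 1)
  rw [d_d]
  exact zero_mem _

/-- The singular boundary as a map from relative cycles to relative cycles. -/
def dCycles (P A A' : Set Y) (k : ℕ) : cycles Y P A (k + 1) →+ cycles Y A A' k :=
  ((d Y (k + 1) k).comp (cycles Y P A (k + 1)).subtype).codRestrict (cycles Y A A' k)
    (fun c => d_mem_cycles A' c.1 c.2)

/-- The connecting map `H_{k+1}(P, A) → H_k(A, A')`, `[c] ↦ [∂c]`, of a triple `A' ⊆ A ⊆ P`. -/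
def connecting (P A A' : Set Y) (k : ℕ) : Homology Y P A (k + 1) →+ Homology Y A A' k :=
  QuotientAddGroup.map _ _ (dCycles P A A' k)
    (by
      rintro ⟨c, hc⟩ h
      change c ∈ boundaries Y P A (k + 1) at h
      change d Y (k + 1) k c ∈ boundaries Y A A' k
      obtain ⟨a, ha, b, ⟨w, hw, rfl⟩, rfl⟩ := AddSubgroup.mem_sup.1 h
      rw [map_add, d_d, add_zero]
      exact AddSubgroup.mem_sup_right ⟨a, ha, rfl⟩)

theorem connecting_connecting (P A A' A'' : Set Y) (k : ℕ) (x : Homology Y P A (k + 2)) :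
    connecting A A' A'' k (connecting P A A' (k + 1) x) = 0 := by
  obtain ⟨⟨c, hc⟩, rfl⟩ := QuotientAddGroup.mk_surjective x
  refine (QuotientAddGroup.eq_zero_iff (N := (boundaries Y A' A'' k).addSubgroupOf _)
    (dCycles A A' A'' k (dCycles P A A' (k + 1) ⟨c, hc⟩))).2 ?_
  change d Y (k + 1) k (d Y (k + 2) (k + 1) c) ∈ boundaries Y A' A'' k
  rw [d_d]
  exact zero_mem _

end Singular

/-! ## Finitely generated based chain complexes and their homology -/

/-- A chain complex of free abelian groups with finite bases (the *cells*), given by its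
incidence numbers `inc k α j = ⟨∂α, j⟩`. -/
structure BasedComplex where
  cell : ℕ → Type u
  fintypeCell : ∀ k, Fintype (cell k)
  inc : ∀ k, cell (k + 1) → cell k → ℤ
  inc_comp : ∀ k (α : cell (k + 2)) (i : cell k), ∑ j, inc (k + 1) α j * inc k j i = 0

attribute [instance] BasedComplex.fintypeCell

namespace BasedComplex

variable (K : BasedComplex.{u})

/-- The `k`-chains with coefficients in `A`. -/
abbrev Chain (A : Type*) (k : ℕ) : Type _ := K.cell k → A

/-- A set of cells in each dimension (used for subcomplexes). -/
abbrev CellSet : Type u := ∀ k, Set (K.cell k)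

/-- All cells: the whole complex. -/
def allCells : K.CellSet := fun _ => Set.univ

/-- No cells: the empty subcomplex. -/
def noCells : K.CellSet := fun _ => ∅

/-- The subcomplex that consists of all cells of dimension `< k` and of the `k`-cells in `S`.
These are exactly the subcomplexes that lie between the `(k-1)`- and the `k`-skeleton. -/
def skeletonWith (k : ℕ) (S : Finset (K.cell k)) : K.CellSet := fun m =>
  {e | m < k ∨ ∃ s ∈ S, (⟨m, e⟩ : Σ m, K.cell m) = ⟨k, s⟩}

section Homology

variable (A : Type*) [CommRing A]

/-- The boundary operator `∂ : C_{k+1} → C_k`. -/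
def boundary (k : ℕ) : K.Chain A (k + 1) →ₗ[A] K.Chain A k where
  toFun c := fun j => ∑ α, c α * (K.inc k α j : A)
  map_add' c c' := by
    funext j
    simp [add_mul, Finset.sum_add_distrib]
  map_smul' a c := by
    funext j
    simp [mul_assoc, Finset.mul_sum]

/-- The boundary operator on `k`-chains, which is zero on `0`-chains. -/
def bdry : ∀ k, K.Chain A k →ₗ[A] K.Chain A (k - 1)
  | 0 => 0
  | k + 1 => K.boundary A k

/-- The chains that are supported on a set of cells. -/
def chainsOn (k : ℕ) (P : K.CellSet) : Submodule A (K.Chain A k) where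
  carrier := {c | ∀ e, e ∉ P k → c e = 0}
  add_mem' := by
    intro a b ha hb e he
    simp [ha e he, hb e he]
  zero_mem' := by
    intro e _
    rfl
  smul_mem' := by
    intro r a ha e he
    simp [ha e he]

/-- Relative cycles of a pair `Q ⊆ P` of subcomplexes. -/
def relCycles (k : ℕ) (P Q : K.CellSet) : Submodule A (K.Chain A k) :=
  K.chainsOn A k P ⊓ (K.chainsOn A (k - 1) Q).comap (K.bdry A k)

/-- Relative boundaries of a pair `Q ⊆ P` of subcomplexes. -/
def relBoundaries (k : ℕ) (P Q : K.CellSet) : Submodule A (K.Chain A k) :=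
  K.chainsOn A k Q ⊔ (K.chainsOn A (k + 1) P).map (K.boundary A k)

/-- The cellular homology `H_k(P, Q; A)` of a pair `Q ⊆ P` of subcomplexes. -/
abbrev RelHomology (k : ℕ) (P Q : K.CellSet) : Type _ :=
  K.relCycles A k P Q ⧸ (K.relBoundaries A k P Q).submoduleOf (K.relCycles A k P Q)

/-- The cellular homology `H_k(P; A)` of a subcomplex. -/
abbrev Homology (k : ℕ) (P : K.CellSet) : Type _ := K.RelHomology A k P K.noCells

theorem chainsOn_mono (k : ℕ) {P P' : K.CellSet} (h : ∀ m, P m ⊆ P' m) :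
    K.chainsOn A k P ≤ K.chainsOn A k P' :=
  fun _ hc e he => hc e (fun he' => he (h k he'))

theorem relCycles_mono (k : ℕ) {P P' : K.CellSet} (Q : K.CellSet) (h : ∀ m, P m ⊆ P' m) :
    K.relCycles A k P Q ≤ K.relCycles A k P' Q :=
  inf_le_inf_right _ (K.chainsOn_mono A k h)

theorem relBoundaries_mono (k : ℕ) {P P' : K.CellSet} (Q : K.CellSet) (h : ∀ m, P m ⊆ P' m) :
    K.relBoundaries A k P Q ≤ K.relBoundaries A k P' Q :=
  sup_le_sup_left (Submodule.map_mono (K.chainsOn_mono A (k + 1) h)) _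

/-- The map `H_k(P; A) → H_k(X; A)` induced by the inclusion of a subcomplex. -/
def homologyToAll (k : ℕ) (P : K.CellSet) : K.Homology A k P →ₗ[A] K.Homology A k K.allCells :=
  Submodule.mapQ _ _
    (Submodule.inclusion (K.relCycles_mono A k K.noCells (fun _ => Set.subset_univ _)))
    (fun _ hc => K.relBoundaries_mono A k K.noCells (fun _ => Set.subset_univ _) hc)

end Homology

/-- The Betti number `β_k` of a subcomplex. -/
def betti (k : ℕ) (P : K.CellSet) : ℕ := Module.finrank ℚ (K.Homology ℚ k P)

/-! ## Spanning trees and co-trees -/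

/-- The `k`-cells `S`, together with the `(k-1)`-skeleton, form a `k`-spanning tree.
(`β_{-1} = 0`, so the condition on `β_{k-1}` is empty for `k = 0`.) -/
def IsSpanningTree (k : ℕ) (S : Finset (K.cell k)) : Prop :=
  Subsingleton (K.Homology ℤ k (K.skeletonWith k S)) ∧
    ∀ m, m + 1 = k → K.betti m (K.skeletonWith k S) = K.betti m K.allCells

/-- The `k`-cells `S`, together with the `(k-1)`-skeleton, form a `k`-spanning co-tree. -/
def IsSpanningCotree (k : ℕ) (S : Finset (K.cell k)) : Prop :=
  Function.Bijective (K.homologyToAll ℚ k (K.skeletonWith k S)) ∧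
    ∀ m, m + 1 = k → K.betti m (K.skeletonWith k S) = K.betti m K.allCells

/-- The order `θ_T` of the torsion subgroup of `H_n(T; ℤ)`, for an `(n+1)`-spanning tree `T`. -/
def treeTorsion (n : ℕ) (T : Finset (K.cell (n + 1))) : ℕ :=
  Nat.card (Submodule.torsion ℤ (K.Homology ℤ n (K.skeletonWith (n + 1) T)))

/-- The order `a_L` of `H_n(X, L; ℤ)`, for an `n`-spanning co-tree `L`. -/
def cotreeIndex (n : ℕ) (L : Finset (K.cell n)) : ℕ :=
  Nat.card (K.RelHomology ℤ n K.allCells (K.skeletonWith n L))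

open Classical in
/-- `δ = ∏_{L,T} a_L θ_T`, over all `n`-spanning co-trees `L` and all `(n+1)`-spanning
trees `T`. -/
def delta (n : ℕ) : ℕ :=
  ∏ L : Finset (K.cell n) with K.IsSpanningCotree n L,
    ∏ T : Finset (K.cell (n + 1)) with K.IsSpanningTree (n + 1) T,
      K.cotreeIndex n L * K.treeTorsion n T

/-! ## The dynamics of the expected cycle and the average current -/

/-- The biased coboundary `e^{-βW} ∂* e^{βE} : C_n(X; ℝ) → C_{n+1}(X; ℝ)`. -/
def biasedCoboundary (n : ℕ) (β : ℝ) (E : K.cell n → ℝ) (W : K.cell (n + 1) → ℝ)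
    (c : K.Chain ℝ n) : K.Chain ℝ (n + 1) :=
  fun α => Real.exp (-(β * W α)) * ∑ j, (K.inc n α j : ℝ) * (Real.exp (β * E j) * c j)

/-- The dynamical operator `H = ∂ e^{-βW} ∂* e^{βE}`. -/
def dynamicalOperator (n : ℕ) (β : ℝ) (E : K.cell n → ℝ) (W : K.cell (n + 1) → ℝ)
    (c : K.Chain ℝ n) : K.Chain ℝ n :=
  K.boundary ℝ n (K.biasedCoboundary n β E W c)

variable {K}

/-- `ρ` is a `1`-periodic solution of `ρ' = -τ H(t) ρ` in the real homology class of `z`. -/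
structure IsPeriodicSolution {n : ℕ} (E : ℝ → K.cell n → ℝ) (W : ℝ → K.cell (n + 1) → ℝ)
    (z : K.Chain ℤ n) (β τ : ℝ) (ρ : ℝ → K.Chain ℝ n) : Prop where
  hasDerivAt : ∀ t, HasDerivAt ρ (-(τ • K.dynamicalOperator n β (E t) (W t) (ρ t))) t
  periodic : Function.Periodic ρ 1
  homologous : ρ 0 - (fun j => (z j : ℝ)) ∈ LinearMap.range (K.boundary ℝ n)

open Classical in
/-- The unique `1`-periodic solution (zero if it fails to exist or to be unique). -/
def periodicSolution {n : ℕ} (E : ℝ → K.cell n → ℝ) (W : ℝ → K.cell (n + 1) → ℝ)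
    (z : K.Chain ℤ n) (β τ : ℝ) : ℝ → K.Chain ℝ n :=
  if h : ∃! ρ, IsPeriodicSolution E W z β τ ρ then h.choose else 0

/-- The current density `J(t) = τ ∂*_{E,W} ρ(t)`. -/
def currentDensity {n : ℕ} (E : ℝ → K.cell n → ℝ) (W : ℝ → K.cell (n + 1) → ℝ)
    (z : K.Chain ℤ n) (β τ : ℝ) (t : ℝ) : K.Chain ℝ (n + 1) :=
  τ • K.biasedCoboundary n β (E t) (W t) (periodicSolution E W z β τ t)

/-- The average current `Q = ∫₀¹ J(t) dt`. -/
def averageCurrent {n : ℕ} (E : ℝ → K.cell n → ℝ) (W : ℝ → K.cell (n + 1) → ℝ)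
    (z : K.Chain ℤ n) (β τ : ℝ) : K.Chain ℝ (n + 1) :=
  ∫ t in (0 : ℝ)..1, currentDensity E W z β τ t

end BasedComplex

/-! ## The cellular chain complex of a finite CW complex -/

namespace CellularChains

open Topology Set

variable (X : Type u) [TopologicalSpace X] [T2Space X] [Topology.CWComplex (univ : Set X)]

/-- The set of `k`-cells of the CW complex `X`. -/
abbrev Cell (k : ℕ) : Type u := RelCWComplex.cell (univ : Set X) k

/-- The union of all cells of dimension `< k`, that is, the `(k-1)`-skeleton. -/
def skel (k : ℕ) : Set X := (RelCWComplex.skeletonLT (univ : Set X) k : Set X)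

/-- The cellular chain group `H_k(X^(k), X^(k-1); ℤ)`. -/
abbrev CellularGroup (k : ℕ) : Type u := Singular.Homology X (skel X (k + 1)) (skel X k) k

/-- The closed `k`-dimensional disk, in the universe of `X`. -/
abbrev Disk (k : ℕ) : Type u := ULift.{u} (Metric.closedBall (0 : Fin k → ℝ) 1)

/-- The boundary sphere of the disk. -/
def diskBoundary (k : ℕ) : Set (Disk.{u} k) := {x | (x.down : Fin k → ℝ) ∈ Metric.sphere 0 1}

variable {X}

/-- The characteristic map of a cell, as a continuous map on the closed disk. -/
def charMap {k : ℕ} (e : Cell X k) : C(Disk.{u} k, X) where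
  toFun x := RelCWComplex.map (C := (univ : Set X)) k e x.down
  continuous_toFun :=
    ((RelCWComplex.continuousOn (C := (univ : Set X)) k e).domRestrict).comp continuous_uliftDown

variable (X)

/-- An orientation of the cells of `X`: for every `k`, the basis of the cellular chain group
`H_k(X^(k), X^(k-1); ℤ)` that is indexed by the `k`-cells and whose element at a cell `e` is the
image of a relative cycle of `(D^k, S^(k-1))` under the characteristic map of `e`. Such a basis
is unique up to the sign of each of its elements. -/
structure Orientation where
  basis : ∀ k, Module.Basis (Cell X k) ℤ (CellularGroup X k)
  basis_eq : ∀ k (e : Cell X k), ∃ z : Singular.cycles X (skel X (k + 1)) (skel X k) k,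
    (z : (Singular.chains X).X k) ∈
      (Singular.cycles (Disk.{u} k) univ (diskBoundary k) k).map
        (Singular.pushforward (charMap e) k) ∧
    basis k e = Singular.homologyClass X z

variable {X}

/-- The incidence number `⟨∂α, j⟩`, with `∂` the connecting map of the skeletal filtration. -/
def Orientation.inc (o : Orientation X) (k : ℕ) (α : Cell X (k + 1)) (j : Cell X k) : ℤ :=
  (o.basis k).repr (Singular.connecting (skel X (k + 2)) (skel X (k + 1)) (skel X k) k
    (o.basis (k + 1) α)) j

theorem finite_cell [RelCWComplex.Finite (univ : Set X)] (k : ℕ) : Finite (Cell X k) :=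
  (inferInstance : RelCWComplex.FiniteType (univ : Set X)).finite_cell k

theorem Orientation.inc_comp (o : Orientation X) (k : ℕ) [Fintype (Cell X (k + 1))]
    (α : Cell X (k + 2)) (i : Cell X k) : ∑ j, o.inc (k + 1) α j * o.inc k j i = 0 := by
  have h := Singular.connecting_connecting (skel X (k + 3)) (skel X (k + 2)) (skel X (k + 1))
    (skel X k) k (o.basis (k + 2) α)
  have hs := (o.basis (k + 1)).sum_repr
    (Singular.connecting (skel X (k + 3)) (skel X (k + 2)) (skel X (k + 1)) (k + 1)
      (o.basis (k + 2) α))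
  have h' := congrArg (fun x => (o.basis k).repr x i) h
  have h2 : (o.basis k).repr (Singular.connecting (skel X (k + 2)) (skel X (k + 1)) (skel X k) k
      (∑ j, o.inc (k + 1) α j • o.basis (k + 1) j)) i = 0 := by
    change (o.basis k).repr (Singular.connecting (skel X (k + 2)) (skel X (k + 1)) (skel X k) k
      (∑ j, (o.basis (k + 1)).repr (Singular.connecting (skel X (k + 3)) (skel X (k + 2))
        (skel X (k + 1)) (k + 1) (o.basis (k + 2) α)) j • o.basis (k + 1) j)) i = 0
    rw [hs]
    simpa using h'
  rw [map_sum, map_sum, Finsupp.finsetSum_apply] at h2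
  rw [← h2]
  refine Finset.sum_congr rfl (fun j _ => ?_)
  rw [map_zsmul, map_zsmul]
  rfl

/-- The cellular chain complex of a finite CW complex with oriented cells. -/
def Orientation.complex [RelCWComplex.Finite (univ : Set X)] (o : Orientation X) :
    BasedComplex.{u} where
  cell k := Cell X k
  fintypeCell k :=
    have := finite_cell (X := X) k
    Fintype.ofFinite _
  inc k := o.inc k
  inc_comp k α i :=
    have := finite_cell (X := X) (k + 1)
    letI : Fintype (Cell X (k + 1)) := Fintype.ofFinite _
    o.inc_comp k α i

end CellularChains

end

/-!
The theorem is linear algebra over the incidence numbers of the `(n+1)`- and `n`-cells, together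
with a low temperature analysis of Gibbs distributions. The topology of `X` enters only through
`∂ ∘ ∂ = 0`.

**Tree formulas.** Let `D` be the surjection `C_{n+1} → im ∂` and `N` the surjection
`C_n → C_n / im ∂`, both written as rational matrices (`Matrix.RankFactorization`). A set of columns
that is a basis for `D` is a spanning tree, and one that is a basis for `N` is a spanning co-tree
(`BasedComplex.isSpanningTree_image`, `BasedComplex.isSpanningCotree_image`). For a surjective
matrix `M` and positive weights `w`, the right inverse of `M` with values orthogonal to `ker M` for
the weights `w⁻¹` is the average of the right inverses supported on bases of columns, with weights
`det² ∏ w`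
(`Matrix.sum_div_mul_columnInverse_eq_zero`, a consequence of Cramer's rule). With the weights
`e^{-βE}` and `e^{-βW}` this expresses the Boltzmann distribution, which is the kernel of the
dynamical operator, and the current with a given boundary through Gibbs distributions `q` on the
bases for `N` and `p` on the bases for `D`.

**Adiabatic limit.** On boundaries the dynamical operator is positive for the inner product
weighted by `e^{βE}`. Evaluating the derivative of this weighted norm where a periodic solution is
largest yields uniqueness, hence existence by a dimension count
(`BasedComplex.exists_existsUnique_isPeriodicSolution`), and the convergence of the periodic
solution to the Boltzmann distribution (`BasedComplex.exists_abs_sub_boltzmann_le`). The current is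
minus the weighted right inverse of `D` applied to the derivative of the density; an integration by
parts gives the limit of its average (`BasedComplex.tendsto_averageCurrent`).

**Zero temperature.** The limit has the form `∫ ∑ C s ν · p_s · dq_ν`. Near a time at which `E` or
`W` is injective, the basis of least energy for `N` or for `D` is unique by the exchange property
(`Matrix.exists_least_columnBasis`), so that `q` or `p` is exponentially close to a constant, while
the derivatives grow only linearly in `β`. With suitable boundary terms the contribution of a short
interval therefore converges to an integral combination of the numbers `C s ν`, and around the loop
the boundary terms cancel (`exists_tendsto_integral_gibbs`). Finally `C s ν` lies in `ℤ[1/δ]`, since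
moving a cycle to a co-tree `L` has denominator `a_L` and filling a boundary in a tree `T` has
denominator `θ_T` (`BasedComplex.columnInverse_sub_mem_adjoin`).
-/

set_option linter.unusedSectionVars false

/-! ### Column bases and weighted right inverses of a matrix -/

namespace Matrix

variable {κ ι F : Type*} [Fintype κ] [DecidableEq κ] [Fintype ι] [DecidableEq ι]

section Field

variable [Field F] (M : Matrix κ ι F) (σ : κ → ι)

/-- The matrix that sends the `i`-th unit vector to the `σ i`-th unit vector. -/
def selection (F : Type*) [Field F] (σ : κ → ι) : Matrix ι κ F :=
  of fun α i => if σ i = α then 1 else 0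

/-- For columns `σ` of `M` that form a basis, the right inverse of `M` with values in the vectors
supported on these columns. It vanishes if the columns do not form a basis. -/
noncomputable def columnInverse : Matrix ι κ F :=
  selection F σ * (M.submatrix id σ)⁻¹

theorem mul_selection : M * selection F σ = M.submatrix id σ := by
  ext k i
  simp [selection, mul_apply]

variable {M σ}

theorem mul_columnInverse (h : (M.submatrix id σ).det ≠ 0) : M * columnInverse M σ = 1 := by
  rw [columnInverse, ← Matrix.mul_assoc, mul_selection, mul_nonsing_inv _ h.isUnit]

theorem injective_of_det_submatrix_ne_zero (h : (M.submatrix id σ).det ≠ 0) :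
    Function.Injective σ := by
  intro i j hij
  by_contra hne
  exact h (det_zero_of_column_eq hne (fun k => by simp [hij]))

variable (M σ) in
theorem columnInverse_mulVec_apply_of_notMem (b : κ → F) {α : ι} (hα : α ∉ Set.range σ) :
    (columnInverse M σ *ᵥ b) α = 0 := by
  rw [columnInverse, ← mulVec_mulVec]
  refine Finset.sum_eq_zero fun i _ => ?_
  have : σ i ≠ α := fun h => hα ⟨i, h⟩
  simp [selection, this]

theorem columnInverse_mulVec_mulVec (h : (M.submatrix id σ).det ≠ 0) {x : ι → F}
    (hx : ∀ α, α ∉ Set.range σ → x α = 0) : columnInverse M σ *ᵥ (M *ᵥ x) = x := by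
  have hsel : selection F σ *ᵥ (x ∘ σ) = x := by
    funext α
    by_cases hα : α ∈ Set.range σ
    · obtain ⟨i, rfl⟩ := hα
      simp [selection, mulVec, dotProduct, (injective_of_det_submatrix_ne_zero h).eq_iff]
    · rw [hx α hα]
      refine Finset.sum_eq_zero fun i _ => ?_
      have : σ i ≠ α := fun h => hα ⟨i, h⟩
      simp [selection, this]
  rw [columnInverse, ← hsel, mulVec_mulVec _ M, mul_selection, mulVec_mulVec, Matrix.mul_assoc,
    nonsing_inv_mul _ h.isUnit, Matrix.mul_one]

theorem columnInverse_eq_of_range_eq {σ' : κ → ι} (h : (M.submatrix id σ).det ≠ 0)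
    (h' : (M.submatrix id σ').det ≠ 0) (hr : Set.range σ = Set.range σ') :
    columnInverse M σ = columnInverse M σ' := by
  refine mulVec_injective (funext fun b => ?_)
  rw [← columnInverse_mulVec_mulVec h' (x := columnInverse M σ *ᵥ b)
    (fun α hα => columnInverse_mulVec_apply_of_notMem M σ b (hr ▸ hα)), mulVec_mulVec _ M,
    mul_columnInverse h, one_mulVec]

variable (M σ) in
/-- Cramer's rule for `columnInverse`. Multiplying by the square of the determinant makes it true
also if the columns `σ` do not form a basis. -/
theorem sq_det_mul_columnInverse_mulVec (b : κ → F) (α : ι) :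
    (M.submatrix id σ).det ^ 2 * (columnInverse M σ *ᵥ b) α =
      ∑ i, if σ i = α then (M.submatrix id σ).det * ((M.submatrix id σ).updateCol i b).det
        else 0 := by
  by_cases h : (M.submatrix id σ).det = 0
  · simp [h]
  · rw [columnInverse, ← mulVec_mulVec, mulVec, dotProduct, Finset.mul_sum]
    refine Finset.sum_congr rfl fun i _ => ?_
    by_cases hi : σ i = α
    · have : ((M.submatrix id σ)⁻¹ *ᵥ b) i =
          (M.submatrix id σ).det⁻¹ * ((M.submatrix id σ).updateCol i b).det := by
        rw [inv_def, smul_mulVec, ← cramer_eq_adjugate_mulVec, Pi.smul_apply, cramer_apply,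
          Ring.inverse_eq_inv', smul_eq_mul]
      simp only [selection, of_apply, hi, if_true, this]
      field_simp
    · simp [selection, hi]

/-- A matrix with a right inverse has a basis among its columns: expand the determinant of
`M * X = 1` in the columns. -/
theorem exists_det_submatrix_ne_zero {X : Matrix ι κ F} (h : M * X = 1) :
    ∃ σ : κ → ι, (M.submatrix id σ).det ≠ 0 := by
  by_contra! hM
  have h1 : (M * X)ᵀ.det = 1 := by rw [h, transpose_one, det_one]
  have h2 : (M * X)ᵀ = fun i => ∑ α, X α i • Mᵀ α := by
    ext i k
    simp [mul_apply, mul_comm]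
  have h3 : (M * X)ᵀ.det = detRowAlternating.toMultilinearMap fun i => ∑ α, X α i • Mᵀ α := by
    rw [← h2]; rfl
  rw [h3, MultilinearMap.map_sum, Finset.sum_eq_zero] at h1
  · exact zero_ne_one h1
  · intro σ _
    rw [MultilinearMap.map_smul_univ]
    have : detRowAlternating.toMultilinearMap (fun i => Mᵀ (σ i)) = (M.submatrix id σ).det := by
      rw [← det_transpose]; rfl
    rw [this, hM, smul_zero]

end Field

section Real

variable (M : Matrix κ ι ℝ)

/-- The tuples of columns of `M` that form a basis. -/
abbrev ColumnBasis : Type _ := {σ : κ → ι // (M.submatrix id σ).det ≠ 0}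

/-- The key orthogonality: the average of the right inverses `columnInverse M σ` with weights
`det(M_σ)² ∏ w(σ i)` takes values in the orthogonal complement of `ker M` for the inner product
weighted by `w⁻¹`. Once the index `i` of the column that pairs with `y` is fixed, the summand
depends on `σ i` only through `y (σ i) det(M_σ)`, and summing over `σ i` produces a determinant
with `M y = 0` as a column. -/
theorem sum_div_mul_columnInverse_eq_zero {w : ι → ℝ} (hw : ∀ α, w α ≠ 0) {y : ι → ℝ}
    (hy : M *ᵥ y = 0) (b : κ → ℝ) :
    ∑ α, y α / w α * ∑ σ : ColumnBasis M,
      (M.submatrix id σ.1).det ^ 2 * (∏ i, w (σ.1 i)) * (columnInverse M σ.1 *ᵥ b) α = 0 := by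
  have h1 : ∀ α, ∑ σ : ColumnBasis M,
      (M.submatrix id σ.1).det ^ 2 * (∏ i, w (σ.1 i)) * (columnInverse M σ.1 *ᵥ b) α =
      ∑ σ : κ → ι, ∑ i, if σ i = α then (∏ i, w (σ i)) * ((M.submatrix id σ).det *
        ((M.submatrix id σ).updateCol i b).det) else 0 := by
    intro α
    have h2 : ∀ σ : κ → ι, (∑ i, if σ i = α then (∏ i, w (σ i)) * ((M.submatrix id σ).det *
        ((M.submatrix id σ).updateCol i b).det) else 0) =
        (M.submatrix id σ).det ^ 2 * (∏ i, w (σ i)) * (columnInverse M σ *ᵥ b) α := by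
      intro σ
      rw [mul_right_comm, sq_det_mul_columnInverse_mulVec, Finset.sum_mul]
      refine Finset.sum_congr rfl fun i _ => ?_
      split_ifs <;> ring
    simp only [h2]
    rw [← Fintype.sum_subtype_add_sum_subtype (fun σ : κ → ι => (M.submatrix id σ).det ≠ 0)]
    refine (add_eq_left.2 (Finset.sum_eq_zero fun σ _ => ?_)).symm
    have := σ.2
    push Not at this
    simp [this]
  have h3 : ∀ i : κ, ∑ σ : κ → ι, (y (σ i) / w (σ i)) * ((∏ i, w (σ i)) *
      ((M.submatrix id σ).det * ((M.submatrix id σ).updateCol i b).det)) = 0 := by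
    intro i
    rw [← (Equiv.funSplitAt i ι).symm.sum_comp, Fintype.sum_prod_type_right]
    refine Finset.sum_eq_zero fun τ _ => ?_
    by_cases hι : Nonempty ι
    swap
    · have := not_nonempty_iff.1 hι
      simp
    obtain ⟨α₀⟩ := hι
    set σ₀ : κ → ι := (Equiv.funSplitAt i ι).symm (α₀, τ) with hσ₀
    have hupd : ∀ α, (Equiv.funSplitAt i ι).symm (α, τ) = Function.update σ₀ i α := by
      intro α
      funext j
      by_cases hj : j = i
      · subst hj; simp
      · simp [hσ₀, hj]
    have hmin : ∀ α, (M.submatrix id (Function.update σ₀ i α)) =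
        (M.submatrix id σ₀).updateCol i (fun k => M k α) := by
      intro α
      ext k j
      by_cases hj : j = i
      · subst hj; simp
      · simp [hj]
    have hprod : ∀ α, ∏ j, w (Function.update σ₀ i α j) =
        w α * ∏ j ∈ Finset.univ.erase i, w (σ₀ j) := by
      intro α
      rw [← Finset.mul_prod_erase _ _ (Finset.mem_univ i)]
      simp only [Function.update_self]
      congr 1
      refine Finset.prod_congr rfl fun j hj => ?_
      rw [Function.update_of_ne (Finset.ne_of_mem_erase hj)]
    have hcol : ∑ α, y α * ((M.submatrix id σ₀).updateCol i (fun k => M k α)).det = 0 := by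
      simp only [← cramer_apply]
      have : ∑ α, y α • cramer (M.submatrix id σ₀) (fun k => M k α) = 0 := by
        simp only [← map_smul]
        rw [← map_sum]
        have : ∑ α, y α • (fun k => M k α) = M *ᵥ y := by
          ext k
          simp [mulVec, dotProduct, mul_comm]
        rw [this, hy, map_zero]
      simpa using congrFun this i
    simp only [hupd, hmin, hprod, updateCol_idem, Function.update_self]
    calc _ = (∑ α, y α * ((M.submatrix id σ₀).updateCol i (fun k => M k α)).det) *
          ((∏ j ∈ Finset.univ.erase i, w (σ₀ j)) * ((M.submatrix id σ₀).updateCol i b).det) := by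
          rw [Finset.sum_mul]
          refine Finset.sum_congr rfl fun α _ => ?_
          have := hw α
          field_simp
      _ = 0 := by rw [hcol, zero_mul]
  simp only [h1, Finset.mul_sum]
  rw [Finset.sum_comm]
  simp only [Finset.sum_comm (s := (Finset.univ : Finset ι))]
  rw [Finset.sum_comm]
  refine Finset.sum_eq_zero fun i _ => ?_
  refine (Finset.sum_congr rfl fun σ _ => ?_).trans (h3 i)
  simp

/-- A right inverse of `M` is determined by the orthogonality of its values to `ker M`. -/
theorem eq_of_mulVec_eq_of_orthogonal {w : ι → ℝ} (hw : ∀ α, 0 < w α) {x x' : ι → ℝ}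
    (h : M *ᵥ x = M *ᵥ x') (hx : ∀ y, M *ᵥ y = 0 → ∑ α, y α / w α * x α = 0)
    (hx' : ∀ y, M *ᵥ y = 0 → ∑ α, y α / w α * x' α = 0) : x = x' := by
  have hy : M *ᵥ (x - x') = 0 := by rw [mulVec_sub, h, sub_self]
  have h0 : ∑ α, (x - x') α ^ 2 / w α = 0 := by
    have h1 := hx _ hy
    have h2 := hx' _ hy
    rw [← sub_eq_zero_of_eq (h1.trans h2.symm), ← Finset.sum_sub_distrib]
    refine Finset.sum_congr rfl fun α _ => ?_
    simp only [Pi.sub_apply]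
    ring
  rw [Finset.sum_eq_zero_iff_of_nonneg
    (fun α _ => div_nonneg (sq_nonneg _) (hw α).le)] at h0
  funext α
  have := h0 α (Finset.mem_univ _)
  rw [div_eq_zero_iff, or_iff_left (hw α).ne', sq_eq_zero_iff, Pi.sub_apply, sub_eq_zero] at this
  exact this

variable {M}

/-- Basis exchange: a column `σ i` of one basis that does not belong to another basis `τ` can
replace some column of `τ` that does not belong to `σ`. -/
theorem exists_exchange {σ τ : κ → ι} (hσ : (M.submatrix id σ).det ≠ 0)
    (hτ : (M.submatrix id τ).det ≠ 0) (i : κ) (hi : σ i ∉ Set.range τ) :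
    ∃ j, τ j ∉ Set.range σ ∧ (M.submatrix id (Function.update τ j (σ i))).det ≠ 0 := by
  set b : κ → ℝ := fun k => M k (σ i) with hb
  have hb' : M *ᵥ (Pi.single (σ i) 1) = b := by
    ext k; simp [hb]
  set x := columnInverse M τ *ᵥ b with hx
  have hMx : M *ᵥ x = b := by rw [hx, mulVec_mulVec, mul_columnInverse hτ, one_mulVec]
  have hxi : x (σ i) = 0 := columnInverse_mulVec_apply_of_notMem M τ b hi
  obtain ⟨α, hασ, hα⟩ : ∃ α, α ∉ Set.range σ ∧ x α ≠ 0 := by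
    by_contra! hcon
    have h1 := columnInverse_mulVec_mulVec hσ hcon
    have h2 := columnInverse_mulVec_mulVec hσ (x := Pi.single (σ i) 1) (by
      intro α hα
      rw [Pi.single_apply, if_neg]
      rintro rfl
      exact hα ⟨i, rfl⟩)
    rw [hMx] at h1
    rw [hb', h1] at h2
    rw [h2] at hxi
    simp at hxi
  obtain ⟨j, rfl⟩ : α ∈ Set.range τ := by
    by_contra hcon
    exact hα (columnInverse_mulVec_apply_of_notMem M τ b hcon)
  refine ⟨j, hασ, ?_⟩
  have hmin : (M.submatrix id (Function.update τ j (σ i))) = (M.submatrix id τ).updateCol j b := by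
    ext k l
    by_cases hl : l = j
    · subst hl; simp [hb]
    · simp [hl]
  have hcr := sq_det_mul_columnInverse_mulVec M τ b (τ j)
  simp only [(injective_of_det_submatrix_ne_zero hτ).eq_iff, Finset.sum_ite_eq',
    Finset.mem_univ, if_true] at hcr
  rw [hmin]
  intro h0
  rw [h0, mul_zero] at hcr
  exact mul_ne_zero (pow_ne_zero 2 hτ) hα hcr

/-- If the weights of the columns are distinct then all bases of least weight give the same right
inverse. -/
theorem exists_least_columnBasis (hM : ∃ σ : κ → ι, (M.submatrix id σ).det ≠ 0) {U : ι → ℝ}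
    (hU : Function.Injective U) :
    ∃ σ₀ : ColumnBasis M, ∀ σ : ColumnBasis M,
      columnInverse M σ.1 = columnInverse M σ₀.1 ∨ ∑ i, U (σ₀.1 i) < ∑ i, U (σ.1 i) := by
  have : Nonempty (ColumnBasis M) := let ⟨σ, h⟩ := hM; ⟨⟨σ, h⟩⟩
  obtain ⟨σ₀, hmin⟩ := Finite.exists_min fun σ : ColumnBasis M => ∑ i, U (σ.1 i)
  refine ⟨σ₀, fun σ => or_iff_not_imp_right.2 fun hσ => ?_⟩
  refine columnInverse_eq_of_range_eq σ.2 σ₀.2 ?_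
  have hmin' : ∀ τ : ColumnBasis M, ∑ i, U (σ.1 i) ≤ ∑ i, U (τ.1 i) :=
    fun τ => (not_lt.1 hσ).trans (hmin τ)
  -- A column of least weight in the symmetric difference would improve the other basis.
  have key : ∀ σ τ : ColumnBasis M, (∀ ν : ColumnBasis M, ∑ i, U (τ.1 i) ≤ ∑ i, U (ν.1 i)) →
      ∀ i, σ.1 i ∉ Set.range τ.1 →
      ∃ j, τ.1 j ∉ Set.range σ.1 ∧ U (τ.1 j) < U (σ.1 i) := by
    intro σ τ hτ i hi
    obtain ⟨j, hj, hdet⟩ := exists_exchange σ.2 τ.2 i hi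
    refine ⟨j, hj, lt_of_le_of_ne ?_ fun h => hi ⟨j, hU h⟩⟩
    have h1 := hτ ⟨_, hdet⟩
    have h2 : ∑ k, U (Function.update τ.1 j (σ.1 i) k) =
        ∑ k, U (τ.1 k) - U (τ.1 j) + U (σ.1 i) := by
      rw [← Finset.add_sum_erase _ _ (Finset.mem_univ j),
        ← Finset.add_sum_erase (a := j) _ (fun k => U (τ.1 k)) (Finset.mem_univ j),
        Function.update_self]
      rw [Finset.sum_congr rfl (g := fun k => U (τ.1 k)) fun k hk => by
        rw [Function.update_of_ne (Finset.ne_of_mem_erase hk)]]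
      ring
    simp only [h2] at h1
    linarith
  by_contra hne
  set P : ι → Prop := fun α => (α ∈ Set.range σ.1 ∧ α ∉ Set.range σ₀.1) ∨
    (α ∈ Set.range σ₀.1 ∧ α ∉ Set.range σ.1) with hP
  have hex : ∃ α, P α := by
    by_contra! hcon
    refine hne (Set.ext fun α => ?_)
    have := hcon α
    simp only [hP] at this
    tauto
  have : Nonempty {α // P α} := let ⟨α, h⟩ := hex; ⟨⟨α, h⟩⟩
  obtain ⟨⟨α, hα⟩, hαmin⟩ := Finite.exists_min fun α : {α // P α} => U α.1
  rcases hα with ⟨⟨i, rfl⟩, h⟩ | ⟨⟨i, rfl⟩, h⟩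
  · obtain ⟨j, hj, hlt⟩ := key σ σ₀ hmin i h
    exact absurd (hαmin ⟨_, Or.inr ⟨⟨j, rfl⟩, hj⟩⟩) (not_le.2 hlt)
  · obtain ⟨j, hj, hlt⟩ := key σ₀ σ hmin' i h
    exact absurd (hαmin ⟨_, Or.inl ⟨⟨j, rfl⟩, hj⟩⟩) (not_le.2 hlt)

end Real

end Matrix

/-! ### Gibbs distributions at low temperature -/

section Gibbs

variable {S : Type*} [Fintype S]

/-- The Gibbs distribution on a finite set with multiplicities `c`, energies `U` and inverse
temperature `β`. -/
noncomputable def gibbs (c : S → ℝ) (β : ℝ) (U : S → ℝ) (s : S) : ℝ :=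
  c s * Real.exp (-(β * U s)) / ∑ r, c r * Real.exp (-(β * U r))

/-- The time derivative of `gibbs c β U` when the energies `U` change at the rate `U'`. -/
noncomputable def gibbsDeriv (c : S → ℝ) (β : ℝ) (U U' : S → ℝ) (s : S) : ℝ :=
  β * (gibbs c β U s * (∑ r, gibbs c β U r * U' r - U' s))

variable {c : S → ℝ} (hc : ∀ s, 0 < c s) (β : ℝ) (U : S → ℝ)

include hc in
theorem partition_pos [Nonempty S] : 0 < ∑ r, c r * Real.exp (-(β * U r)) :=
  Finset.sum_pos (fun r _ => mul_pos (hc r) (Real.exp_pos _)) Finset.univ_nonempty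

include hc in
theorem gibbs_nonneg (s : S) : 0 ≤ gibbs c β U s :=
  div_nonneg (mul_pos (hc s) (Real.exp_pos _)).le
    (Finset.sum_nonneg fun r _ => (mul_pos (hc r) (Real.exp_pos _)).le)

include hc in
theorem sum_gibbs [Nonempty S] : ∑ s, gibbs c β U s = 1 := by
  simp only [gibbs, ← Finset.sum_div]
  exact div_self (partition_pos hc β U).ne'

include hc in
theorem gibbs_le_one [Nonempty S] (s : S) : gibbs c β U s ≤ 1 := by
  rw [← sum_gibbs hc β U]
  exact Finset.single_le_sum (fun r _ => gibbs_nonneg hc β U r) (Finset.mem_univ s)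

include hc in
theorem gibbs_le_of_gap {β : ℝ} (hβ : 0 ≤ β) {s₀ s : S} {g : ℝ} (hg : g ≤ U s - U s₀) :
    gibbs c β U s ≤ c s / c s₀ * Real.exp (-(g * β)) := by
  have h1 : 0 < c s₀ * Real.exp (-(β * U s₀)) := mul_pos (hc s₀) (Real.exp_pos _)
  calc gibbs c β U s ≤ c s * Real.exp (-(β * U s)) / (c s₀ * Real.exp (-(β * U s₀))) :=
        div_le_div_of_nonneg_left (mul_pos (hc s) (Real.exp_pos _)).le h1
          (Finset.single_le_sum (f := fun r => c r * Real.exp (-(β * U r)))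
            (fun r _ => (mul_pos (hc r) (Real.exp_pos _)).le) (Finset.mem_univ s₀))
    _ = c s / c s₀ * Real.exp (-(β * (U s - U s₀))) := by
        rw [mul_div_mul_comm, ← Real.exp_sub]
        congr 2
        ring
    _ ≤ c s / c s₀ * Real.exp (-(g * β)) := by
        refine mul_le_mul_of_nonneg_left (Real.exp_le_exp.2 ?_) (div_pos (hc s) (hc s₀)).le
        nlinarith

include hc in
theorem abs_gibbsDeriv_le [Nonempty S] {β : ℝ} (hβ : 0 ≤ β) {U' : S → ℝ} {K : ℝ}
    (hK : ∀ s, |U' s| ≤ K) (s : S) : |gibbsDeriv c β U U' s| ≤ 2 * K * β * gibbs c β U s := by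
  have h1 : |∑ r, gibbs c β U r * U' r| ≤ K := by
    calc |∑ r, gibbs c β U r * U' r| ≤ ∑ r, |gibbs c β U r * U' r| :=
          Finset.abs_sum_le_sum_abs _ _
      _ ≤ ∑ r, gibbs c β U r * K := by
          refine Finset.sum_le_sum fun r _ => ?_
          rw [abs_mul, abs_of_nonneg (gibbs_nonneg hc β U r)]
          exact mul_le_mul_of_nonneg_left (hK r) (gibbs_nonneg hc β U r)
      _ = K := by rw [← Finset.sum_mul, sum_gibbs hc, one_mul]
  have h2 : |∑ r, gibbs c β U r * U' r - U' s| ≤ 2 * K :=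
    (abs_sub _ _).trans (by linarith [hK s])
  rw [gibbsDeriv, abs_mul, abs_mul, abs_of_nonneg hβ, abs_of_nonneg (gibbs_nonneg hc β U s)]
  calc β * (gibbs c β U s * |∑ r, gibbs c β U r * U' r - U' s|)
      ≤ β * (gibbs c β U s * (2 * K)) := by
        gcongr
        exact gibbs_nonneg hc β U s
    _ = _ := by ring

include hc in
theorem sum_gibbsDeriv [Nonempty S] (U' : S → ℝ) : ∑ s, gibbsDeriv c β U U' s = 0 := by
  simp only [gibbsDeriv, ← Finset.mul_sum, mul_sub, Finset.sum_sub_distrib, ← Finset.sum_mul,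
    sum_gibbs hc]
  ring

variable {β}

include hc in
theorem HasDerivAt.gibbs [Nonempty S] {U : ℝ → S → ℝ} {U' : S → ℝ} {t : ℝ}
    (hU : ∀ s, HasDerivAt (fun t => U t s) (U' s) t) (s : S) :
    HasDerivAt (fun t => gibbs c β (U t) s) (gibbsDeriv c β (U t) U' s) t := by
  have hterm : ∀ r, HasDerivAt (fun t => c r * Real.exp (-(β * U t r)))
      (c r * (Real.exp (-(β * U t r)) * -(β * U' r))) t := fun r =>
    (((hU r).const_mul β).neg.exp).const_mul (c r)
  have hsum : HasDerivAt (fun t => ∑ r, c r * Real.exp (-(β * U t r)))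
      (∑ r, c r * (Real.exp (-(β * U t r)) * -(β * U' r))) t :=
    HasDerivAt.fun_sum fun r _ => hterm r
  have hZ := (partition_pos hc β (U t)).ne'
  refine ((hterm s).div hsum hZ).congr_deriv ?_
  set Z := ∑ r, c r * Real.exp (-(β * U t r)) with hZdef
  have h1 : ∑ r, c r * (Real.exp (-(β * U t r)) * -(β * U' r)) =
      -(β * Z * ∑ r, _root_.gibbs c β (U t) r * U' r) := by
    rw [Finset.mul_sum, ← Finset.sum_neg_distrib]
    refine Finset.sum_congr rfl fun r _ => ?_
    rw [_root_.gibbs, ← hZdef]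
    field_simp
  rw [h1, gibbsDeriv, _root_.gibbs, ← hZdef]
  field_simp
  ring

end Gibbs

section GibbsIntegral

variable {S N : Type*} [Fintype S] [Fintype N] [Nonempty S] [Nonempty N]
  {c : S → ℝ} {d : N → ℝ} (hc : ∀ s, 0 < c s) (hd : ∀ ν, 0 < d ν)
  {U U' : ℝ → S → ℝ} {V V' : ℝ → N → ℝ}
  (hU : ∀ t s, HasDerivAt (fun t => U t s) (U' t s) t) (hU' : ∀ s, Continuous fun t => U' t s)
  (hV : ∀ t ν, HasDerivAt (fun t => V t ν) (V' t ν) t) (hV' : ∀ ν, Continuous fun t => V' t ν)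

include hc hU in
theorem continuous_gibbs (β : ℝ) (s : S) : Continuous fun t => gibbs c β (U t) s :=
  continuous_iff_continuousAt.2 fun t => (HasDerivAt.gibbs hc (hU t) s).continuousAt

include hc hU hU' in
theorem continuous_gibbsDeriv (β : ℝ) (s : S) :
    Continuous fun t => gibbsDeriv c β (U t) (U' t) s := by
  have h := continuous_gibbs (β := β) hc hU
  unfold gibbsDeriv
  fun_prop

theorem tendsto_const_mul_self_mul_exp_neg (C : ℝ) {g : ℝ} (hg : 0 < g) :
    Tendsto (fun β : ℝ => C * (β * Real.exp (-(g * β)))) atTop (𝓝 0) := by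
  have h := Real.tendsto_pow_mul_exp_neg_atTop_nhds_zero 1
  have h2 : Tendsto (fun β : ℝ => g * β) atTop atTop := tendsto_id.const_mul_atTop hg
  have h3 := (h.comp h2).const_mul (C / g)
  rw [mul_zero] at h3
  refine h3.congr fun β => ?_
  simp only [Function.comp_apply, pow_one]
  field_simp

theorem tendsto_const_mul_exp_neg (C : ℝ) {g : ℝ} (hg : 0 < g) :
    Tendsto (fun β : ℝ => C * Real.exp (-(g * β))) atTop (𝓝 0) := by
  have h2 : Tendsto (fun β : ℝ => g * β) atTop atTop := tendsto_id.const_mul_atTop hg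
  simpa using (Real.tendsto_exp_neg_atTop_nhds_zero.comp h2).const_mul C

include hc in
theorem tendsto_gibbs_of_gap {u : S → ℝ} {g : ℝ} (hg : 0 < g) {s₀ s : S}
    (hgap : g ≤ u s - u s₀) : Tendsto (fun β => gibbs c β u s) atTop (𝓝 0) := by
  refine squeeze_zero' (Eventually.of_forall fun β => gibbs_nonneg hc β u s) ?_
    (tendsto_const_mul_exp_neg (c s / c s₀) hg)
  filter_upwards [eventually_ge_atTop 0] with β hβ
  exact gibbs_le_of_gap hc u hβ hgap

include hc hd in
/-- If the energy of `s` stays above that of another state, then `p_s` is exponentially small in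
`β`, whereas the derivatives of the probabilities `q_ν` are at most of order `β`. -/
theorem tendsto_integral_gibbs_mul_gibbsDeriv_of_gap {K : ℝ} (hK : ∀ t ν, |V' t ν| ≤ K)
    {a b g : ℝ} (hab : a ≤ b) (hg : 0 < g) {s₀ s : S} (ν : N)
    (hgap : ∀ t ∈ Set.Icc a b, g ≤ U t s - U t s₀) :
    Tendsto (fun β => ∫ t in a..b, gibbs c β (U t) s * gibbsDeriv d β (V t) (V' t) ν)
      atTop (𝓝 0) := by
  have hK0 : 0 ≤ K := (abs_nonneg _).trans (hK 0 ν)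
  refine squeeze_zero_norm' ?_
    (tendsto_const_mul_self_mul_exp_neg (c s / c s₀ * (2 * K) * |b - a|) hg)
  filter_upwards [eventually_ge_atTop 0] with β hβ
  have : ∀ t ∈ Set.uIoc a b, ‖gibbs c β (U t) s * gibbsDeriv d β (V t) (V' t) ν‖ ≤
      c s / c s₀ * Real.exp (-(g * β)) * (2 * K * β) := by
    intro t ht
    rw [Set.uIoc_of_le hab] at ht
    rw [norm_mul, Real.norm_eq_abs, Real.norm_eq_abs, abs_of_nonneg (gibbs_nonneg hc β _ s)]
    refine mul_le_mul (gibbs_le_of_gap hc _ hβ (hgap t ⟨ht.1.le, ht.2⟩)) ?_ (abs_nonneg _)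
      (mul_pos (div_pos (hc s) (hc s₀)) (Real.exp_pos _)).le
    refine (abs_gibbsDeriv_le hd _ hβ (hK t) ν).trans ?_
    exact mul_le_of_le_one_right (by positivity) (gibbs_le_one hd _ _ _)
  refine (intervalIntegral.norm_integral_le_of_norm_le_const this).trans (le_of_eq ?_)
  ring

include hc hd hU hU' hV hV' in
theorem integral_gibbs_mul_gibbsDeriv (β a b : ℝ) (s : S) (ν : N) :
    ∫ t in a..b, gibbs c β (U t) s * gibbsDeriv d β (V t) (V' t) ν =
      gibbs c β (U b) s * gibbs d β (V b) ν - gibbs c β (U a) s * gibbs d β (V a) ν -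
      ∫ t in a..b, gibbsDeriv c β (U t) (U' t) s * gibbs d β (V t) ν :=
  intervalIntegral.integral_mul_deriv_eq_deriv_mul
    (fun t _ => HasDerivAt.gibbs hc (hU t) s) (fun t _ => HasDerivAt.gibbs hd (hV t) ν)
    ((continuous_gibbsDeriv hc hU hU' β s).intervalIntegrable _ _)
    ((continuous_gibbsDeriv hd hV hV' β ν).intervalIntegrable _ _)

include hc hd hU hU' hV hV' in
/-- The same conclusion if the energy of `ν` stays above that of another state: integrate by
parts. -/
theorem tendsto_integral_gibbs_mul_gibbsDeriv_of_gap' {K : ℝ} (hK : ∀ t s, |U' t s| ≤ K)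
    {a b g : ℝ} (hab : a ≤ b) (hg : 0 < g) (s : S) {ν₀ ν : N}
    (hgap : ∀ t ∈ Set.Icc a b, g ≤ V t ν - V t ν₀) :
    Tendsto (fun β => ∫ t in a..b, gibbs c β (U t) s * gibbsDeriv d β (V t) (V' t) ν)
      atTop (𝓝 0) := by
  simp only [integral_gibbs_mul_gibbsDeriv hc hd hU hU' hV hV']
  have h1 : ∀ t ∈ Set.Icc a b,
      Tendsto (fun β => gibbs c β (U t) s * gibbs d β (V t) ν) atTop (𝓝 0) := fun t ht =>
    squeeze_zero (fun β => mul_nonneg (gibbs_nonneg hc _ _ _) (gibbs_nonneg hd _ _ _))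
      (fun β => mul_le_of_le_one_left (gibbs_nonneg hd _ _ _) (gibbs_le_one hc _ _ _))
      (tendsto_gibbs_of_gap hd hg (hgap t ht))
  have h2 := tendsto_integral_gibbs_mul_gibbsDeriv_of_gap hd hc (V := U) hK hab hg s hgap
  have h3 : Tendsto (fun β => ∫ t in a..b, gibbsDeriv c β (U t) (U' t) s * gibbs d β (V t) ν)
      atTop (𝓝 0) := h2.congr fun β => by simp only [mul_comm]
  simpa using ((h1 b ⟨hab, le_rfl⟩).sub (h1 a ⟨le_rfl, hab⟩)).sub h3

/-- Finitely many strict inequalities at a time `t₀` hold with a uniform gap at nearby times. -/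
theorem exists_gap {S : Type*} [Finite S] {P : S → Prop} {f : S → ℝ → ℝ}
    (hf : ∀ s, Continuous (f s)) {t₀ : ℝ} (h : ∀ s, P s ∨ 0 < f s t₀) :
    ∃ g > 0, ∃ ε > 0, ∀ t, |t - t₀| < ε → ∀ s, P s ∨ g ≤ f s t := by
  have h1 : ∀ᶠ g in 𝓝[>] (0 : ℝ), ∀ s, P s ∨ g < f s t₀ := by
    refine eventually_all.2 fun s => ?_
    rcases h s with h | h
    · exact Eventually.of_forall fun _ => Or.inl h
    · filter_upwards [Ioo_mem_nhdsGT h] with g hg using Or.inr hg.2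
  obtain ⟨g, hg, hg0⟩ := (h1.and self_mem_nhdsWithin).exists
  have h2 : ∀ᶠ t in 𝓝 t₀, ∀ s, P s ∨ g ≤ f s t := by
    refine eventually_all.2 fun s => ?_
    rcases hg s with h | h
    · exact Eventually.of_forall fun _ => Or.inl h
    · filter_upwards [(hf s).continuousAt.eventually (lt_mem_nhds h)] with t ht using Or.inr ht.le
  obtain ⟨ε, hε, h3⟩ := Metric.eventually_nhds_iff.1 h2
  exact ⟨g, hg0, ε, hε, fun t ht => h3 ht⟩

/-- A relation on the points of an interval that holds between near points and can be composed
holds between the end points. -/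
theorem rel_of_local {r : ℝ → ℝ → Prop} (htrans : ∀ a b c, r a b → r b c → r a c) {a b : ℝ}
    (hab : a ≤ b)
    (hloc : ∀ t ∈ Set.Icc a b, ∃ ε > 0, ∀ x y, |x - t| < ε → |y - t| < ε → x ≤ y → r x y) :
    r a b := by
  choose! ε hε hr using hloc
  obtain ⟨x, hx0, hmono, ⟨m, hm⟩, hx⟩ := exists_monotone_Icc_subset_open_cover_Icc hab
    (c := fun t : Set.Icc a b => {y : Set.Icc a b | |y.1 - t.1| < ε t.1})
    (fun t => isOpen_lt (by fun_prop) continuous_const)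
    (fun t _ => Set.mem_iUnion.2 ⟨t, by simpa using hε t t.2⟩)
  have hstep : ∀ n, r (x n) (x (n + 1)) := by
    intro n
    obtain ⟨t, ht⟩ := hx n
    have hle := hmono (Nat.le_succ n)
    exact hr t t.2 _ _ (ht ⟨le_rfl, hle⟩) (ht ⟨hle, le_rfl⟩) hle
  have h0 : ∀ n, r (x 0) (x (n + 1)) := by
    intro n
    induction n with
    | zero => exact hstep 0
    | succ n ih => exact htrans _ _ _ ih (hstep _)
  have := h0 m
  rw [hx0, hm (m + 1) (Nat.le_succ m)] at this
  exact this

include hc hd hU hU' hV hV' in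
/-- **Quantization for Gibbs distributions.** Let two systems of energies `U`, `V` run through a
loop, and suppose that at each time the minimal energy of one of them is attained, up to states
that `C` does not distinguish, at a single state. Then `∫ ∑ C s ν · p_s · dq_ν`, with `p` and `q`
the Gibbs distributions of `U` and `V`, converges at zero temperature to an element of the group
generated by the numbers `C s ν`. -/
theorem exists_tendsto_integral_gibbs {K : ℝ} (hKU : ∀ t s, |U' t s| ≤ K)
    (hKV : ∀ t ν, |V' t ν| ≤ K) (hU1 : U 1 = U 0) (hV1 : V 1 = V 0) {C : S → N → ℝ}
    {Λ : AddSubgroup ℝ} (hC : ∀ s ν, C s ν ∈ Λ)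
    (hgood : ∀ t, (∃ s₀, ∀ s, C s = C s₀ ∨ U t s₀ < U t s) ∨
      ∃ ν₀, ∀ ν, (∀ s, C s ν = C s ν₀) ∨ V t ν₀ < V t ν) :
    ∃ l ∈ Λ, Tendsto (fun β => ∫ t in (0 : ℝ)..1, ∑ s, ∑ ν,
      C s ν * (gibbs c β (U t) s * gibbsDeriv d β (V t) (V' t) ν)) atTop (𝓝 l) := by
  classical
  -- The state of least energy, if `C` distinguishes only one such state.
  set ground : (S → ℝ) → S := fun u =>
    if h : ∃ s₀, ∀ s, C s = C s₀ ∨ u s₀ < u s then h.choose else Classical.arbitrary S with hground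
  have ground_eq : ∀ u s₀, (∀ s, C s = C s₀ ∨ u s₀ < u s) → C (ground u) = C s₀ := by
    intro u s₀ h
    have hex : ∃ s₀, ∀ s, C s = C s₀ ∨ u s₀ < u s := ⟨s₀, h⟩
    have hdef : ground u = hex.choose := by simp only [hground]; rw [dif_pos hex]
    have hspec := hex.choose_spec
    rw [hdef]
    rcases h hex.choose with h1 | h1
    · exact h1
    · rcases hspec s₀ with h2 | h2
      · exact h2.symm
      · exact absurd h1 h2.asymm
  set m : ℝ → S := fun t => ground (U t) with hm
  -- Corrected by boundary terms, the integrals over short intervals converge in `Λ`.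
  set B : ℝ → ℝ → ℝ := fun β t => ∑ ν, C (m t) ν * gibbs d β (V t) ν with hB
  set I : ℝ → ℝ → ℝ → ℝ := fun β a b => ∫ t in a..b, ∑ s, ∑ ν,
    C s ν * (gibbs c β (U t) s * gibbsDeriv d β (V t) (V' t) ν) with hI
  have hcont : ∀ β (s : S) (ν : N),
      Continuous fun t => gibbs c β (U t) s * gibbsDeriv d β (V t) (V' t) ν := fun β s ν =>
    (continuous_gibbs hc hU β s).mul (continuous_gibbsDeriv hd hV hV' β ν)
  have hIsum : ∀ (D : S → N → ℝ) β a b, (∫ t in a..b, ∑ s, ∑ ν,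
      D s ν * (gibbs c β (U t) s * gibbsDeriv d β (V t) (V' t) ν)) =
      ∑ s, ∑ ν, D s ν * ∫ t in a..b, gibbs c β (U t) s * gibbsDeriv d β (V t) (V' t) ν := by
    intro D β a b
    rw [intervalIntegral.integral_finsetSum fun s _ => Continuous.intervalIntegrable
      (continuous_finsetSum _ fun ν _ => (hcont β s ν).const_mul _) _ _]
    refine Finset.sum_congr rfl fun s _ => ?_
    rw [intervalIntegral.integral_finsetSum fun ν _ => Continuous.intervalIntegrable
      ((hcont β s ν).const_mul _) _ _]
    exact Finset.sum_congr rfl fun ν _ => intervalIntegral.integral_const_mul _ _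
  have hIadd : ∀ β a b e, I β a b + I β b e = I β a e := fun β a b e =>
    intervalIntegral.integral_add_adjacent_intervals
      (Continuous.intervalIntegrable (continuous_finsetSum _ fun s _ =>
        continuous_finsetSum _ fun ν _ => (hcont β s ν).const_mul _) _ _)
      (Continuous.intervalIntegrable (continuous_finsetSum _ fun s _ =>
        continuous_finsetSum _ fun ν _ => (hcont β s ν).const_mul _) _ _)
  have key : ∃ l ∈ Λ, Tendsto (fun β => I β 0 1 - B β 1 + B β 0) atTop (𝓝 l) := by
    refine rel_of_local
      (r := fun a b => ∃ l ∈ Λ, Tendsto (fun β => I β a b - B β b + B β a) atTop (𝓝 l))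
      ?_ zero_le_one ?_
    · rintro a b e ⟨l, hl, h⟩ ⟨l', hl', h'⟩
      refine ⟨l + l', add_mem hl hl', (h.add h').congr fun β => ?_⟩
      rw [← hIadd β a b e]
      ring
    · intro t₀ _
      rcases hgood t₀ with ⟨s₀, hs₀⟩ | ⟨ν₀, hν₀⟩
      · obtain ⟨g, hg, ε, hε, hgap⟩ := exists_gap (P := fun s => C s = C s₀)
          (f := fun s t => U t s - U t s₀)
          (fun s => (continuous_iff_continuousAt.2 fun t => (hU t s).continuousAt).sub
            (continuous_iff_continuousAt.2 fun t => (hU t s₀).continuousAt)) (t₀ := t₀)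
          (fun s => (hs₀ s).imp_right sub_pos.2)
        refine ⟨ε, hε, fun a b ha hb hab => ⟨0, zero_mem Λ, ?_⟩⟩
        have hmt : ∀ t, |t - t₀| < ε → C (m t) = C s₀ := fun t ht =>
          ground_eq _ _ fun s => (hgap t ht s).imp_right fun h => sub_pos.1 (hg.trans_le h)
        have hsub : ∀ t ∈ Set.Icc a b, |t - t₀| < ε := by
          intro t ht
          rw [abs_lt] at ha hb ⊢
          exact ⟨by linarith [ht.1], by linarith [ht.2]⟩
        have hconv : Tendsto (fun β => ∑ s, ∑ ν, (C s ν - C s₀ ν) *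
            ∫ t in a..b, gibbs c β (U t) s * gibbsDeriv d β (V t) (V' t) ν) atTop
            (𝓝 (∑ _s : S, ∑ _ν : N, 0)) := by
          refine tendsto_finsetSum _ fun s _ => tendsto_finsetSum _ fun ν _ => ?_
          by_cases hs : C s = C s₀
          · simp [hs]
          · have := tendsto_integral_gibbs_mul_gibbsDeriv_of_gap hc hd (V := V) hKV hab hg
              (s₀ := s₀) (s := s) ν (fun t ht => (hgap t (hsub t ht) s).resolve_left hs)
            simpa using this.const_mul (C s ν - C s₀ ν)
        simp only [Finset.sum_const_zero] at hconv
        refine hconv.congr fun β => ?_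
        have h1 : B β b - B β a = ∑ s, ∑ ν, C s₀ ν *
            ∫ t in a..b, gibbs c β (U t) s * gibbsDeriv d β (V t) (V' t) ν := by
          rw [Finset.sum_comm]
          simp only [hB, hmt a ha, hmt b hb]
          rw [← Finset.sum_sub_distrib]
          refine Finset.sum_congr rfl fun ν _ => ?_
          rw [← Finset.mul_sum, ← mul_sub, ← intervalIntegral.integral_finsetSum
            fun s _ => (hcont β s ν).intervalIntegrable _ _]
          simp only [← Finset.sum_mul, sum_gibbs hc, one_mul]
          rw [intervalIntegral.integral_eq_sub_of_hasDerivAt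
            (fun t _ => HasDerivAt.gibbs hd (hV t) ν)
            ((continuous_gibbsDeriv hd hV hV' β ν).intervalIntegrable _ _)]
        have h2 : I β a b - B β b + B β a = I β a b - (B β b - B β a) := by ring
        rw [h2, h1]
        simp only [hI, hIsum, sub_mul, Finset.sum_sub_distrib]
      · obtain ⟨g, hg, ε, hε, hgap⟩ := exists_gap (P := fun ν => ∀ s, C s ν = C s ν₀)
          (f := fun ν t => V t ν - V t ν₀)
          (fun ν => (continuous_iff_continuousAt.2 fun t => (hV t ν).continuousAt).sub
            (continuous_iff_continuousAt.2 fun t => (hV t ν₀).continuousAt)) (t₀ := t₀)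
          (fun ν => (hν₀ ν).imp_right sub_pos.2)
        refine ⟨ε, hε, fun a b ha hb hab =>
          ⟨0 - C (m b) ν₀ + C (m a) ν₀, add_mem (sub_mem (zero_mem Λ) (hC _ _)) (hC _ _), ?_⟩⟩
        have hsub : ∀ t ∈ Set.Icc a b, |t - t₀| < ε := by
          intro t ht
          rw [abs_lt] at ha hb ⊢
          exact ⟨by linarith [ht.1], by linarith [ht.2]⟩
        have hBlim : ∀ t, |t - t₀| < ε → Tendsto (fun β => B β t) atTop (𝓝 (C (m t) ν₀)) := by
          intro t ht
          have h1 : Tendsto (fun β => C (m t) ν₀ +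
              ∑ ν, (C (m t) ν - C (m t) ν₀) * gibbs d β (V t) ν) atTop
              (𝓝 (C (m t) ν₀ + ∑ _ν : N, 0)) := by
            refine tendsto_const_nhds.add (tendsto_finsetSum _ fun ν _ => ?_)
            by_cases hs : ∀ s, C s ν = C s ν₀
            · simp [hs]
            · have := tendsto_gibbs_of_gap hd hg ((hgap t ht ν).resolve_left hs)
              simpa using this.const_mul (C (m t) ν - C (m t) ν₀)
          simp only [Finset.sum_const_zero, add_zero] at h1
          refine h1.congr fun β => ?_
          simp only [hB, sub_mul, Finset.sum_sub_distrib, ← Finset.mul_sum, sum_gibbs hd]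
          ring
        have hconv : Tendsto (fun β => ∑ s, ∑ ν, (C s ν - C s ν₀) *
            ∫ t in a..b, gibbs c β (U t) s * gibbsDeriv d β (V t) (V' t) ν) atTop
            (𝓝 (∑ _s : S, ∑ _ν : N, 0)) := by
          refine tendsto_finsetSum _ fun s _ => tendsto_finsetSum _ fun ν _ => ?_
          by_cases hs : ∀ s, C s ν = C s ν₀
          · simp [hs]
          · have := tendsto_integral_gibbs_mul_gibbsDeriv_of_gap' hc hd hU hU' hV hV' hKU hab hg
              s (ν₀ := ν₀) (ν := ν) (fun t ht => (hgap t (hsub t ht) ν).resolve_left hs)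
            simpa using this.const_mul (C s ν - C s ν₀)
        simp only [Finset.sum_const_zero] at hconv
        refine ((hconv.sub (hBlim b hb)).add (hBlim a ha)).congr fun β => ?_
        congr 2
        simp only [hI, hIsum, sub_mul, Finset.sum_sub_distrib]
        refine sub_eq_self.2 (Finset.sum_eq_zero fun s _ => ?_)
        rw [← Finset.mul_sum, ← intervalIntegral.integral_finsetSum
            fun ν _ => (hcont β s ν).intervalIntegrable _ _]
        simp only [← Finset.mul_sum, sum_gibbsDeriv hd, mul_zero,
          intervalIntegral.integral_zero]
  obtain ⟨l, hl, hlim⟩ := key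
  refine ⟨l, hl, hlim.congr fun β => ?_⟩
  have : B β 1 = B β 0 := by simp only [hB, hm, hU1, hV1]
  rw [this]
  ring

end GibbsIntegral

/-! ### Periodic solutions of linear differential equations -/

section LinearODE

variable {V : Type*} [NormedAddCommGroup V] [NormedSpace ℝ V]

theorem exists_norm_le_of_periodic {f : ℝ → V} (hf : Continuous f) (hper : Function.Periodic f 1) :
    ∃ K, 0 ≤ K ∧ ∀ t, ‖f t‖ ≤ K := by
  obtain ⟨K, hK⟩ := isCompact_Icc.exists_bound_of_continuousOn (s := Set.Icc (0 : ℝ) 1)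
    hf.continuousOn
  have h : ∀ t, ‖f t‖ ≤ K := by
    intro t
    obtain ⟨s, hs, hst⟩ := hper.exists_mem_Ico₀ one_pos t
    rw [hst]
    exact hK s ⟨hs.1, hs.2.le⟩
  exact ⟨K, (norm_nonneg _).trans (h 0), h⟩

theorem hasDerivWithinAt_Icc_of_Icc {f f' : ℝ → V} {a b c : ℝ} (hab : a ≤ b) (hbc : b ≤ c)
    (h1 : ∀ t ∈ Set.Icc a b, HasDerivWithinAt f (f' t) (Set.Icc a b) t)
    (h2 : ∀ t ∈ Set.Icc b c, HasDerivWithinAt f (f' t) (Set.Icc b c) t) :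
    ∀ t ∈ Set.Icc a c, HasDerivWithinAt f (f' t) (Set.Icc a c) t := by
  intro t ht
  rcases lt_trichotomy t b with h | rfl | h
  · refine (h1 t ⟨ht.1, h.le⟩).mono_of_mem_nhdsWithin ?_
    filter_upwards [self_mem_nhdsWithin, mem_nhdsWithin_of_mem_nhds (Iio_mem_nhds h)] with s hs hs'
      using ⟨hs.1, le_of_lt hs'⟩
  · rw [← Set.Icc_union_Icc_eq_Icc hab hbc]
    exact (h1 t ⟨hab, le_rfl⟩).union (h2 t ⟨le_rfl, hbc⟩)
  · refine (h2 t ⟨h.le, ht.2⟩).mono_of_mem_nhdsWithin ?_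
    filter_upwards [self_mem_nhdsWithin, mem_nhdsWithin_of_mem_nhds (Ioi_mem_nhds h)] with s hs hs'
      using ⟨le_of_lt hs', hs.2⟩

/-- A solution on a period with equal values at its ends extends to a periodic solution. -/
theorem exists_periodic_extension {u : ℝ → V} {F : ℝ → V → V}
    (hF : ∀ t v, F (t + 1) v = F t v) (h01 : u 1 = u 0)
    (hu : ∀ t ∈ Set.Icc (0 : ℝ) 1, HasDerivWithinAt u (F t (u t)) (Set.Icc 0 1) t) :
    ∃ w : ℝ → V, w 0 = u 0 ∧ Function.Periodic w 1 ∧ ∀ t, HasDerivAt w (F t (w t)) t := by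
  set w : ℝ → V := fun t => u (Int.fract t) with hw
  have hFint : ∀ (k : ℤ) t v, F (t - k) v = F t v := by
    intro k t v
    have h : Function.Periodic (fun t => F t v) 1 := fun t => hF t v
    simpa using h.sub_int_mul_eq (x := t) k
  have hwk : ∀ (k : ℤ), ∀ t ∈ Set.Icc (k : ℝ) (k + 1), w t = u (t - k) := by
    intro k t ht
    rcases eq_or_lt_of_le ht.2 with h | h
    · have : (k : ℝ) + 1 = ((k + 1 : ℤ) : ℝ) := by push_cast; ring
      simp only [hw, h, this, Int.fract_intCast]
      push_cast
      rw [add_sub_cancel_left, h01]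
    · have : ⌊t⌋ = k := Int.floor_eq_iff.2 ⟨ht.1, h⟩
      simp only [hw, Int.fract, this]
  have hder : ∀ (k : ℤ), ∀ t ∈ Set.Icc (k : ℝ) (k + 1),
      HasDerivWithinAt w (F t (w t)) (Set.Icc (k : ℝ) (k + 1)) t := by
    intro k t ht
    have hmem : ∀ s ∈ Set.Icc (k : ℝ) (k + 1), s - k ∈ Set.Icc (0 : ℝ) 1 := fun s hs =>
      ⟨by linarith [hs.1], by linarith [hs.2]⟩
    have h1 : HasDerivWithinAt (fun s => s - (k : ℝ)) 1 (Set.Icc (k : ℝ) (k + 1)) t :=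
      (hasDerivWithinAt_id t _).sub_const _
    have h2 := (hu (t - k) (hmem t ht)).scomp t h1 hmem
    rw [one_smul, ← hwk k t ht, hFint] at h2
    exact h2.congr_of_mem (hwk k) ht
  refine ⟨w, by simp [hw], fun t => by simp [hw], fun t => ?_⟩
  have hfl := Int.floor_le t
  have hfl' := Int.lt_floor_add_one t
  have hk : (⌊t⌋ : ℝ) - 1 = ((⌊t⌋ - 1 : ℤ) : ℝ) := by push_cast; ring
  have h1 : ∀ s ∈ Set.Icc ((⌊t⌋ : ℝ) - 1) ⌊t⌋,
      HasDerivWithinAt w (F s (w s)) (Set.Icc ((⌊t⌋ : ℝ) - 1) ⌊t⌋) s := by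
    have := hder (⌊t⌋ - 1)
    rw [← hk, sub_add_cancel] at this
    exact this
  refine (hasDerivWithinAt_Icc_of_Icc (f' := fun t => F t (w t)) (by linarith) (by linarith) h1
    (hder ⌊t⌋) t ⟨by linarith, hfl'.le⟩).hasDerivAt (Icc_mem_nhds (by linarith) hfl')

variable {A : ℝ → V →L[ℝ] V}

/-- The length of the interval of existence does not depend on the initial time and value. -/
theorem exists_local_solution [CompleteSpace V] (hA : Continuous A) {K : ℝ} (hK0 : 0 ≤ K)
    (hK : ∀ t, ‖A t‖ ≤ K) (t₀ : ℝ) (x : V) :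
    ∃ u : ℝ → V, u t₀ = x ∧ ∀ t ∈ Set.Icc t₀ (t₀ + (2 * (K + 1))⁻¹),
      HasDerivWithinAt u (A t (u t)) (Set.Icc t₀ (t₀ + (2 * (K + 1))⁻¹)) t := by
  set h := (2 * (K + 1))⁻¹ with hh
  have hh0 : 0 < h := by positivity
  lift K to NNReal using hK0
  have hpl : IsPicardLindelof (fun t v => A t v) (tmin := t₀) (tmax := t₀ + h)
      ⟨t₀, le_rfl, by linarith⟩ x (‖x‖₊ + 1) 0 (K * (2 * ‖x‖₊ + 1)) K := by
    refine ⟨fun t _ => ?_, fun v _ => ?_, fun t _ v hv => ?_, ?_⟩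
    · exact ((A t).lipschitz.weaken (hK t)).lipschitzOnWith
    · exact (hA.clm_apply continuous_const).continuousOn
    · refine ((A t).le_of_opNorm_le (hK t) v).trans ?_
      have h1 : ‖v‖ ≤ 2 * ‖x‖ + 1 := by
        have h2 : ‖v - x‖ ≤ ‖x‖ + 1 := by simpa [dist_eq_norm] using hv
        have h3 := norm_le_norm_add_norm_sub' v x
        linarith
      push_cast
      exact mul_le_mul_of_nonneg_left h1 K.2
    · push_cast
      simp only [add_sub_cancel_left, sub_self, sub_zero, max_eq_left hh0.le]
      rw [hh, ← div_eq_mul_inv, div_le_iff₀ (by positivity)]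
      have h1 := norm_nonneg x
      have h2 := K.2
      nlinarith [mul_nonneg h1 h2]
  exact hpl.exists_eq_forall_mem_Icc_hasDerivWithinAt₀

theorem exists_solution_Icc [CompleteSpace V] (hA : Continuous A) {K : ℝ} (hK0 : 0 ≤ K)
    (hK : ∀ t, ‖A t‖ ≤ K) (x : V) :
    ∃ u : ℝ → V, u 0 = x ∧ ∀ t ∈ Set.Icc (0 : ℝ) 1,
      HasDerivWithinAt u (A t (u t)) (Set.Icc 0 1) t := by
  set h := (2 * (K + 1))⁻¹ with hh
  have hh0 : 0 < h := by positivity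
  have hsteps : ∀ n : ℕ, ∃ u : ℝ → V, u 0 = x ∧ ∀ t ∈ Set.Icc (0 : ℝ) (n * h),
      HasDerivWithinAt u (A t (u t)) (Set.Icc 0 (n * h)) t := by
    intro n
    induction n with
    | zero =>
      obtain ⟨u, hu0, hu⟩ := exists_local_solution hA hK0 hK 0 x
      refine ⟨u, hu0, fun t ht => ?_⟩
      have hsub : Set.Icc (0 : ℝ) ((0 : ℕ) * h) ⊆ Set.Icc 0 (0 + (2 * (K + 1))⁻¹) :=
        Set.Icc_subset_Icc_right (by simp only [Nat.cast_zero, zero_mul, zero_add]; positivity)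
      exact (hu t (hsub ht)).mono hsub
    | succ n ih =>
      obtain ⟨u, hu0, hu⟩ := ih
      obtain ⟨v, hv0, hv⟩ := exists_local_solution hA hK0 hK (n * h) (u (n * h))
      have hn : 0 ≤ (n : ℝ) * h := by positivity
      set w : ℝ → V := fun t => if t ≤ n * h then u t else v t with hw
      have hwu : ∀ t ∈ Set.Icc (0 : ℝ) (n * h), w t = u t := fun t ht => if_pos ht.2
      have hwv : ∀ t ∈ Set.Icc (n * h) (n * h + h), w t = v t := by
        intro t ht
        rcases eq_or_lt_of_le ht.1 with h | h
        · rw [hw, ← h]; simp [hv0]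
        · exact if_neg (not_le.2 h)
      refine ⟨w, (hwu 0 ⟨le_rfl, hn⟩).trans hu0, ?_⟩
      have hsucc : ((n + 1 : ℕ) : ℝ) * h = n * h + h := by push_cast; ring
      rw [hsucc]
      refine hasDerivWithinAt_Icc_of_Icc (f' := fun t => A t (w t)) hn (by linarith)
        (fun t ht => ?_) (fun t ht => ?_)
      · rw [hwu t ht]
        exact (hu t ht).congr_of_mem hwu ht
      · rw [hwv t ht]
        exact (hv t ht).congr_of_mem hwv ht
  obtain ⟨n, hn⟩ := exists_nat_ge h⁻¹
  obtain ⟨u, hu0, hu⟩ := hsteps n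
  have hsub : Set.Icc (0 : ℝ) 1 ⊆ Set.Icc 0 (n * h) := by
    refine Set.Icc_subset_Icc_right ?_
    calc (1 : ℝ) = h⁻¹ * h := (inv_mul_cancel₀ hh0.ne').symm
      _ ≤ n * h := mul_le_mul_of_nonneg_right hn hh0.le
  exact ⟨u, hu0, fun t ht => (hu t (hsub ht)).mono hsub⟩

theorem hasDerivWithinAt_Ici_of_Icc {u u' : ℝ → V} {a b : ℝ}
    (hu : ∀ t ∈ Set.Icc a b, HasDerivWithinAt u (u' t) (Set.Icc a b) t) :
    ∀ t ∈ Set.Ico a b, HasDerivWithinAt u (u' t) (Set.Ici t) t := fun t ht =>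
  (hu t ⟨ht.1, ht.2.le⟩).mono_of_mem_nhdsWithin
    (mem_of_superset (Icc_mem_nhdsGE ht.2) (Set.Icc_subset_Icc_left ht.1))

/-- If a periodic linear equation preserves the cosets of `ker N`, and has no nonzero periodic
solution in `ker N`, then it has a periodic solution in each coset: the map that moves `ker N`
by one period has no nonzero fixed vector, so `1` is not among its eigenvalues. -/
theorem exists_periodic_solution [FiniteDimensional ℝ V] {W : Type*} [NormedAddCommGroup W]
    [NormedSpace ℝ W] (hA : Continuous A) (hper : Function.Periodic A 1) (N : V →L[ℝ] W)
    (hN : ∀ t v, N (A t v) = 0)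
    (huniq : ∀ u : ℝ → V, Function.Periodic u 1 → (∀ t, HasDerivAt u (A t (u t)) t) →
      N (u 0) = 0 → u 0 = 0) (x₀ : V) :
    ∃ u : ℝ → V, Function.Periodic u 1 ∧ (∀ t, HasDerivAt u (A t (u t)) t) ∧
      N (u 0) = N x₀ := by
  have := FiniteDimensional.complete ℝ V
  obtain ⟨K, hK0, hK⟩ := exists_norm_le_of_periodic hA hper
  choose sol hsol0 hsol using exists_solution_Icc hA hK0 hK
  have hcont : ∀ x, ContinuousOn (sol x) (Set.Icc 0 1) := fun x t ht =>
    (hsol x t ht).continuousWithinAt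
  have hlip : ∀ t, LipschitzWith ⟨K, hK0⟩ (A t) := fun t => (A t).lipschitz.weaken (hK t)
  have h1mem : (1 : ℝ) ∈ Set.Icc (0 : ℝ) 1 := ⟨zero_le_one, le_rfl⟩
  have hadd : ∀ x y, sol (x + y) 1 = sol x 1 + sol y 1 := by
    intro x y
    refine ODE_solution_unique hlip (hcont _) (hasDerivWithinAt_Ici_of_Icc (hsol _))
      ((hcont x).add (hcont y)) (fun t ht => ?_) ?_ h1mem
    · have := (hasDerivWithinAt_Ici_of_Icc (hsol x) t ht).add
        (hasDerivWithinAt_Ici_of_Icc (hsol y) t ht)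
      rw [← map_add] at this
      exact this
    · simp [hsol0]
  have hsmul : ∀ (a : ℝ) x, sol (a • x) 1 = a • sol x 1 := by
    intro a x
    refine ODE_solution_unique hlip (hcont _) (hasDerivWithinAt_Ici_of_Icc (hsol _))
      ((hcont x).const_smul a) (fun t ht => ?_) ?_ h1mem
    · have := (hasDerivWithinAt_Ici_of_Icc (hsol x) t ht).const_smul a
      rw [← map_smul] at this
      exact this
    · simp [hsol0]
  have hNsol : ∀ x, N (sol x 1) = N x := by
    intro x
    have h := constant_of_has_deriv_right_zero (f := fun t => N (sol x t)) (a := 0) (b := 1)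
      (N.continuous.comp_continuousOn (hcont x)) (fun t ht => by
        have := (N.hasFDerivAt).comp_hasDerivWithinAt t (hasDerivWithinAt_Ici_of_Icc (hsol x) t ht)
        rw [hN] at this
        exact this) 1 h1mem
    simpa [hsol0] using h
  have hext : ∀ x, sol x 1 = x → ∃ w : ℝ → V, w 0 = x ∧ Function.Periodic w 1 ∧
      ∀ t, HasDerivAt w (A t (w t)) t := by
    intro x hx
    obtain ⟨w, hw0, hw⟩ := exists_periodic_extension (F := fun t v => A t v)
      (fun t v => by rw [hper t]) (hx.trans (hsol0 x).symm) (hsol x)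
    exact ⟨w, hw0.trans (hsol0 x), hw⟩
  set P : Submodule ℝ V := LinearMap.ker N.toLinearMap with hP
  have hmemP : ∀ v, v ∈ P ↔ N v = 0 := fun v => LinearMap.mem_ker
  set Ψ : V →ₗ[ℝ] V :=
    { toFun := fun x => sol x 1 - x
      map_add' := fun x y => by rw [hadd]; abel
      map_smul' := fun a x => by rw [hsmul, RingHom.id_apply, smul_sub] } with hΨ
  have hΨP : ∀ x, Ψ x ∈ P := fun x => by
    rw [hmemP]
    change N (sol x 1 - x) = 0
    rw [map_sub, hNsol, sub_self]
  set Ψ' : P →ₗ[ℝ] P := (Ψ.comp P.subtype).codRestrict P fun x => hΨP x with hΨ'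
  have hinj : Function.Injective Ψ' := by
    rw [← LinearMap.ker_eq_bot, LinearMap.ker_eq_bot']
    rintro ⟨x, hx⟩ h
    have h1 : sol x 1 - x = 0 := congrArg Subtype.val h
    obtain ⟨w, hw0, hwper, hw⟩ := hext x (sub_eq_zero.1 h1)
    refine Subtype.ext ?_
    have := huniq w hwper hw (by rw [hw0]; exact (hmemP x).1 hx)
    exact hw0.symm.trans this
  obtain ⟨⟨b, hb⟩, hbΨ⟩ := LinearMap.surjective_of_injective hinj ⟨Ψ (-x₀), hΨP _⟩
  have hbΨ' : Ψ b = Ψ (-x₀) := congrArg Subtype.val hbΨ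
  have hfix : sol (x₀ + b) 1 = x₀ + b := by
    have : Ψ (x₀ + b) = 0 := by rw [map_add, hbΨ', map_neg, add_neg_cancel]
    exact sub_eq_zero.1 this
  obtain ⟨w, hw0, hwper, hw⟩ := hext _ hfix
  refine ⟨w, hwper, hw, ?_⟩
  rw [hw0, map_add, (hmemP b).1 hb, add_zero]

end LinearODE

/-! ### Rank factorizations -/

namespace Matrix

/-- For a matrix `B`: a surjection `D` that represents `B` as a map onto its image, and a
surjection `N` that represents the quotient map onto its cokernel. Here `ψ` is the inclusion of the
image, with left inverse `φ`, the matrices `X` and `Y` are right inverses of `D` and `N`, and `Z`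
witnesses that `ker N` is contained in the image of `B`. All conditions are identities between
matrices, so they persist under extension of the field. -/
structure RankFactorization {m p F : Type*} [Fintype m] [DecidableEq m] [Fintype p] [Field F]
    (B : Matrix m p F) where
  r : ℕ
  s : ℕ
  D : Matrix (Fin r) p F
  φ : Matrix (Fin r) m F
  ψ : Matrix m (Fin r) F
  X : Matrix p (Fin r) F
  N : Matrix (Fin s) m F
  Y : Matrix m (Fin s) F
  Z : Matrix p m F
  φ_mul : φ * B = D
  ψ_mul : ψ * D = B
  mul_X : D * X = 1
  N_mul : N * B = 0
  mul_Y : N * Y = 1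
  one_eq : 1 = Y * N + B * Z

namespace RankFactorization

variable {m p F F' : Type*} [Fintype m] [DecidableEq m] [Fintype p] [Field F] [Field F']
  {B : Matrix m p F}

theorem exists_rankFactorization [DecidableEq p] (B : Matrix m p F) :
    Nonempty (RankFactorization B) := by
  set f := toLin' B with hf
  obtain ⟨r, D, ψ, hψD, hD, hψ⟩ : ∃ (r : ℕ) (D : (p → F) →ₗ[F] Fin r → F)
      (ψ : (Fin r → F) →ₗ[F] m → F),
      ψ.comp D = f ∧ Function.Surjective D ∧ Function.Injective ψ := by
    set e := (Module.finBasis F (LinearMap.range f)).equivFun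
    refine ⟨_, e.toLinearMap.comp f.rangeRestrict,
      (LinearMap.range f).subtype.comp e.symm.toLinearMap, ?_,
      e.surjective.comp f.surjective_rangeRestrict,
      (LinearMap.range f).injective_subtype.comp e.symm.injective⟩
    refine LinearMap.ext fun x => ?_
    simp
  obtain ⟨s, N, hN, hNker⟩ : ∃ (s : ℕ) (N : (m → F) →ₗ[F] Fin s → F),
      Function.Surjective N ∧ LinearMap.ker N = LinearMap.range f := by
    set e := (Module.finBasis F ((m → F) ⧸ LinearMap.range f)).equivFun
    refine ⟨_, e.toLinearMap.comp (LinearMap.range f).mkQ,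
      e.surjective.comp (LinearMap.range f).mkQ_surjective, ?_⟩
    rw [LinearEquiv.ker_comp, Submodule.ker_mkQ]
  obtain ⟨X, hX⟩ := D.exists_rightInverse_of_surjective (LinearMap.range_eq_top.2 hD)
  obtain ⟨φ, hφ⟩ := ψ.exists_leftInverse_of_injective (LinearMap.ker_eq_bot.2 hψ)
  obtain ⟨Y, hY⟩ := N.exists_rightInverse_of_surjective (LinearMap.range_eq_top.2 hN)
  have hNf : N.comp f = 0 := LinearMap.range_le_ker_iff.1 hNker.ge
  have hφf : φ.comp f = D := by rw [← hψD, ← LinearMap.comp_assoc, hφ, LinearMap.id_comp]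
  have hZ : LinearMap.id = Y.comp N + f.comp (X.comp (φ.comp (LinearMap.id - Y.comp N))) := by
    refine LinearMap.ext fun v => ?_
    have hv : v - Y (N v) ∈ LinearMap.range f := by
      rw [← hNker, LinearMap.mem_ker, map_sub, ← LinearMap.comp_apply N, hY, LinearMap.id_apply,
        sub_self]
    obtain ⟨x, hx⟩ := hv
    have h1 : f (X (φ (v - Y (N v)))) = v - Y (N v) := by
      rw [← hx, ← LinearMap.comp_apply φ, hφf, ← hψD, LinearMap.comp_apply ψ,
        ← LinearMap.comp_apply D, hX, LinearMap.id_apply, LinearMap.comp_apply]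
    simp only [LinearMap.id_apply, LinearMap.add_apply, LinearMap.comp_apply,
      LinearMap.sub_apply, h1, add_sub_cancel]
  refine ⟨⟨_, _, LinearMap.toMatrix' D, LinearMap.toMatrix' φ, LinearMap.toMatrix' ψ,
    LinearMap.toMatrix' X, LinearMap.toMatrix' N, LinearMap.toMatrix' Y,
    LinearMap.toMatrix' (X.comp (φ.comp (LinearMap.id - Y.comp N))), ?_, ?_, ?_, ?_, ?_, ?_⟩⟩
  · rw [← hφf, LinearMap.toMatrix'_comp, hf, LinearMap.toMatrix'_toLin']
  · rw [← LinearMap.toMatrix'_comp, hψD, hf, LinearMap.toMatrix'_toLin']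
  · rw [← LinearMap.toMatrix'_comp, hX, LinearMap.toMatrix'_id]
  · have := congrArg LinearMap.toMatrix' hNf
    rwa [LinearMap.toMatrix'_comp, hf, LinearMap.toMatrix'_toLin', map_zero] at this
  · rw [← LinearMap.toMatrix'_comp, hY, LinearMap.toMatrix'_id]
  · have := congrArg LinearMap.toMatrix' hZ
    rwa [map_add, LinearMap.toMatrix'_comp, LinearMap.toMatrix'_comp f, hf,
      LinearMap.toMatrix'_toLin', LinearMap.toMatrix'_id] at this

/-- Extension of the field. -/
abbrev map (R : RankFactorization B) (f : F →+* F') {B' : Matrix m p F'} (hB : B.map f = B') :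
    RankFactorization B' where
  r := R.r
  s := R.s
  D := R.D.map f
  φ := R.φ.map f
  ψ := R.ψ.map f
  X := R.X.map f
  N := R.N.map f
  Y := R.Y.map f
  Z := R.Z.map f
  φ_mul := by rw [← hB, ← Matrix.map_mul, R.φ_mul]
  ψ_mul := by rw [← hB, ← Matrix.map_mul, R.ψ_mul]
  mul_X := by rw [← Matrix.map_mul, R.mul_X]; simp
  N_mul := by rw [← hB, ← Matrix.map_mul, R.N_mul]; simp
  mul_Y := by rw [← Matrix.map_mul, R.mul_Y]; simp
  one_eq := by
    rw [← hB, ← Matrix.map_mul, ← Matrix.map_mul, ← Matrix.map_add _ (map_add f), ← R.one_eq]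
    simp

variable (R : RankFactorization B)

theorem D_mulVec_eq_zero_iff {x : p → F} : R.D *ᵥ x = 0 ↔ B *ᵥ x = 0 :=
  ⟨fun h => by rw [← R.ψ_mul, ← mulVec_mulVec, h, mulVec_zero],
    fun h => by rw [← R.φ_mul, ← mulVec_mulVec, h, mulVec_zero]⟩

theorem φ_mulVec_mulVec (x : p → F) : R.φ *ᵥ (B *ᵥ x) = R.D *ᵥ x := by
  rw [mulVec_mulVec, R.φ_mul]

theorem ψ_mulVec_mulVec (x : p → F) : R.ψ *ᵥ (R.D *ᵥ x) = B *ᵥ x := by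
  rw [mulVec_mulVec, R.ψ_mul]

theorem N_mulVec_mulVec (x : p → F) : R.N *ᵥ (B *ᵥ x) = 0 := by
  rw [mulVec_mulVec, R.N_mul, zero_mulVec]

/-- Exactness: the kernel of `N` is the image of `B`. -/
theorem eq_of_N_mulVec_eq_zero {c : m → F} (h : R.N *ᵥ c = 0) : c = B *ᵥ (R.Z *ᵥ c) := by
  conv_lhs => rw [← one_mulVec c, R.one_eq, add_mulVec, ← mulVec_mulVec, h, mulVec_zero, zero_add,
    ← mulVec_mulVec]

end RankFactorization

end Matrix

theorem exists_int_multiple {ι : Type*} [Finite ι] (f : ι → ℚ) :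
    ∃ m : ℤ, m ≠ 0 ∧ ∃ g : ι → ℤ, ∀ i, (g i : ℚ) = m * f i := by
  obtain ⟨⟨m, hm⟩, h⟩ := IsLocalization.exist_integer_multiples_of_finite (nonZeroDivisors ℤ) f
  choose g hg using h
  refine ⟨m, nonZeroDivisors.ne_zero hm, g, fun i => ?_⟩
  have := hg i
  simpa using this

/-! ### Spanning trees and co-trees as bases of columns -/

namespace BasedComplex

open Matrix

variable (K : BasedComplex.{u})

/-- The matrix of the boundary operator `C_{n+1} → C_n`. -/
def boundaryMatrix (A : Type*) [CommRing A] (n : ℕ) : Matrix (K.cell n) (K.cell (n + 1)) A :=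
  of fun j α => (K.inc n α j : A)

section Chains

variable (A : Type*) [CommRing A]

theorem boundary_eq_mulVec (n : ℕ) (c : K.Chain A (n + 1)) :
    K.boundary A n c = K.boundaryMatrix A n *ᵥ c := by
  funext j
  exact Finset.sum_congr rfl fun α _ => mul_comm _ _

theorem boundaryMatrix_map {A' : Type*} [CommRing A'] (f : A →+* A') (n : ℕ) :
    (K.boundaryMatrix A n).map f = K.boundaryMatrix A' n := by
  ext j α
  simp [boundaryMatrix]

theorem boundary_comp_map {A' : Type*} [CommRing A'] (f : A →+* A') (n : ℕ)
    (c : K.Chain A (n + 1)) : K.boundary A' n (f ∘ c) = f ∘ K.boundary A n c := by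
  funext j
  simp [boundary]

theorem bdry_boundary (n : ℕ) (c : K.Chain A (n + 1)) : K.bdry A n (K.boundary A n c) = 0 := by
  cases n with
  | zero => rfl
  | succ n =>
    funext i
    change ∑ j, (∑ α, c α * (K.inc (n + 1) α j : A)) * (K.inc n j i : A) = 0
    simp only [Finset.sum_mul]
    rw [Finset.sum_comm]
    refine Finset.sum_eq_zero fun α _ => ?_
    simp only [mul_assoc, ← Finset.mul_sum]
    have := congrArg (Int.cast : ℤ → A) (K.inc_comp n α i)
    push_cast at this
    rw [this, mul_zero]

theorem chainsOn_noCells (k : ℕ) : K.chainsOn A k K.noCells = ⊥ := by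
  ext c
  exact ⟨fun h => funext fun e => h e (Set.notMem_empty e), fun h e _ => congrFun h e⟩

theorem chainsOn_allCells (k : ℕ) : K.chainsOn A k K.allCells = ⊤ :=
  eq_top_iff.2 fun _ _ e he => absurd (Set.mem_univ e) he

theorem chainsOn_skeletonWith_of_lt {m k : ℕ} (h : m < k) (S : Finset (K.cell k)) :
    K.chainsOn A m (K.skeletonWith k S) = ⊤ :=
  eq_top_iff.2 fun _ _ _ he => absurd (Or.inl h) he

variable {A} in
theorem mem_chainsOn_skeletonWith {k : ℕ} {S : Finset (K.cell k)} {c : K.Chain A k} :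
    c ∈ K.chainsOn A k (K.skeletonWith k S) ↔ ∀ e, e ∉ S → c e = 0 := by
  have : ∀ e : K.cell k, e ∈ K.skeletonWith k S k ↔ e ∈ S := by
    intro e
    refine ⟨?_, fun he => Or.inr ⟨e, he, rfl⟩⟩
    rintro (h | ⟨s, hs, h⟩)
    · exact absurd h (lt_irrefl k)
    · obtain rfl : e = s := by simpa using h
      exact hs
  exact forall_congr' fun e => by rw [this]

theorem relCycles_eq_of_chainsOn_eq (k : ℕ) {P P' : K.CellSet} (Q : K.CellSet)
    (h : K.chainsOn A k P = K.chainsOn A k P') : K.relCycles A k P Q = K.relCycles A k P' Q := by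
  rw [relCycles, relCycles, h]

variable {A} in
theorem mem_relCycles_noCells {k : ℕ} {P : K.CellSet} {c : K.Chain A k} :
    c ∈ K.relCycles A k P K.noCells ↔ c ∈ K.chainsOn A k P ∧ K.bdry A k c = 0 := by
  rw [relCycles, chainsOn_noCells, Submodule.mem_inf, Submodule.mem_comap, Submodule.mem_bot]

theorem relBoundaries_noCells (k : ℕ) (P : K.CellSet) :
    K.relBoundaries A k P K.noCells = (K.chainsOn A (k + 1) P).map (K.boundary A k) := by
  rw [relBoundaries, chainsOn_noCells, bot_sup_eq]

theorem relBoundaries_le_relCycles {k : ℕ} {P : K.CellSet} (hP : K.chainsOn A k P = ⊤) :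
    K.relBoundaries A k P K.noCells ≤ K.relCycles A k P K.noCells := by
  rw [relBoundaries_noCells]
  rintro _ ⟨c, -, rfl⟩
  exact (K.mem_relCycles_noCells).2 ⟨hP ▸ Submodule.mem_top, K.bdry_boundary A k c⟩

theorem betti_add_finrank {k : ℕ} {P : K.CellSet} (hP : K.chainsOn ℚ k P = ⊤) :
    K.betti k P + Module.finrank ℚ (K.relBoundaries ℚ k P K.noCells) =
      Module.finrank ℚ (K.relCycles ℚ k P K.noCells) := by
  rw [← (Submodule.submoduleOfEquivOfLe (K.relBoundaries_le_relCycles ℚ hP)).finrank_eq]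
  exact Submodule.finrank_quotient_add_finrank _

/-- If `P` contains all `k`-cells, its Betti number `β_k` is that of the whole complex exactly if
the `(k+1)`-cells of `P` have the same boundaries. -/
theorem betti_eq_iff {k : ℕ} {P : K.CellSet} (hP : K.chainsOn ℚ k P = ⊤) :
    K.betti k P = K.betti k K.allCells ↔
      (K.chainsOn ℚ (k + 1) P).map (K.boundary ℚ k) = LinearMap.range (K.boundary ℚ k) := by
  have h1 := K.betti_add_finrank hP
  have h2 := K.betti_add_finrank (K.chainsOn_allCells ℚ k)
  rw [K.relCycles_eq_of_chainsOn_eq ℚ k K.noCells (hP.trans (K.chainsOn_allCells ℚ k).symm)] at h1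
  rw [relBoundaries_noCells] at h1 h2
  rw [chainsOn_allCells, Submodule.map_top] at h2
  constructor
  · intro h
    refine Submodule.eq_of_le_of_finrank_eq ?_ (by omega)
    rintro _ ⟨c, -, rfl⟩
    exact ⟨c, rfl⟩
  · intro h
    rw [h] at h1
    omega

variable {A} in
/-- The homology class of a relative cycle. -/
def relClass {k : ℕ} {P Q : K.CellSet} (c : K.Chain A k) (hc : c ∈ K.relCycles A k P Q) :
    K.RelHomology A k P Q :=
  Submodule.Quotient.mk ⟨c, hc⟩

variable {A} in
theorem relClass_eq_zero_iff {k : ℕ} {P Q : K.CellSet} {c : K.Chain A k}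
    {hc : c ∈ K.relCycles A k P Q} : K.relClass c hc = 0 ↔ c ∈ K.relBoundaries A k P Q := by
  rw [relClass, Submodule.Quotient.mk_eq_zero, Submodule.submoduleOf, Submodule.mem_comap,
    Submodule.subtype_apply]

theorem exists_eq_relClass {k : ℕ} {P Q : K.CellSet} (x : K.RelHomology A k P Q) :
    ∃ c hc, x = K.relClass c hc := by
  obtain ⟨⟨c, hc⟩, h⟩ := Submodule.Quotient.mk_surjective _ x
  exact ⟨c, hc, h.symm⟩

theorem smul_relClass (a : A) {k : ℕ} {P Q : K.CellSet} {c : K.Chain A k}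
    (hc : c ∈ K.relCycles A k P Q) :
    a • K.relClass c hc = K.relClass (a • c) (Submodule.smul_mem _ a hc) := rfl

theorem nsmul_relClass (a : ℕ) {k : ℕ} {P Q : K.CellSet} {c : K.Chain A k}
    (hc : c ∈ K.relCycles A k P Q) :
    a • K.relClass c hc = K.relClass (a • c) (nsmul_mem hc a) := rfl

theorem relClass_sub {k : ℕ} {P Q : K.CellSet} {c c' : K.Chain A k}
    (hc : c ∈ K.relCycles A k P Q) (hc' : c' ∈ K.relCycles A k P Q) :
    K.relClass c hc - K.relClass c' hc' = K.relClass (c - c') (sub_mem hc hc') := rfl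

theorem homologyToAll_relClass {k : ℕ} {P : K.CellSet} {c : K.Chain A k}
    (hc : c ∈ K.relCycles A k P K.noCells) :
    K.homologyToAll A k P (K.relClass c hc) =
      K.relClass c
        (K.relCycles_mono A k (P' := K.allCells) K.noCells (fun _ => Set.subset_univ _) hc) := rfl

end Chains

section Trees

variable {K} {n : ℕ} [DecidableEq (K.cell n)] (R : RankFactorization (K.boundaryMatrix ℚ n))

theorem boundary_columnInverse {F : Type*} [Field F]
    (R : RankFactorization (K.boundaryMatrix F n)) [DecidableEq (K.cell (n + 1))]
    {σ : Fin R.r → K.cell (n + 1)}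
    (hσ : (R.D.submatrix id σ).det ≠ 0) (v : K.Chain F (n + 1)) :
    K.boundary F n (columnInverse R.D σ *ᵥ (R.D *ᵥ v)) = K.boundary F n v := by
  rw [boundary_eq_mulVec, boundary_eq_mulVec, ← R.ψ_mulVec_mulVec, ← R.ψ_mulVec_mulVec v,
    mulVec_mulVec _ R.D, mul_columnInverse hσ, one_mulVec]

theorem columnInverse_mem_chainsOn {F κ : Type*} [Field F] [Fintype κ] [DecidableEq κ] {k : ℕ}
    [DecidableEq (K.cell k)] (M : Matrix κ (K.cell k) F) (σ : κ → K.cell k) (b : κ → F) :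
    columnInverse M σ *ᵥ b ∈ K.chainsOn F k (K.skeletonWith k (Finset.univ.image σ)) := by
  rw [mem_chainsOn_skeletonWith]
  intro e he
  refine columnInverse_mulVec_apply_of_notMem M σ b ?_
  rintro ⟨i, rfl⟩
  exact he (Finset.mem_image_of_mem σ (Finset.mem_univ i))

theorem columnInverse_mulVec_of_mem_chainsOn {F κ : Type*} [Field F] [Fintype κ] [DecidableEq κ]
    {k : ℕ} [DecidableEq (K.cell k)] {M : Matrix κ (K.cell k) F} {σ : κ → K.cell k}
    (hσ : (M.submatrix id σ).det ≠ 0) {c : K.Chain F k}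
    (hc : c ∈ K.chainsOn F k (K.skeletonWith k (Finset.univ.image σ))) :
    columnInverse M σ *ᵥ (M *ᵥ c) = c := by
  rw [mem_chainsOn_skeletonWith] at hc
  refine columnInverse_mulVec_mulVec hσ fun e he => hc e fun h => he ?_
  obtain ⟨i, -, rfl⟩ := Finset.mem_image.1 h
  exact ⟨i, rfl⟩

theorem cast_mem_chainsOn {F : Type*} [CommRing F] {k : ℕ} {P : K.CellSet} {c : K.Chain ℤ k}
    (hc : c ∈ K.chainsOn ℤ k P) : (fun e => (c e : F)) ∈ K.chainsOn F k P := fun e he => by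
  simp [hc e he]

theorem mem_chainsOn_of_cast {k : ℕ} {P : K.CellSet} {c : K.Chain ℚ k} {m : ℤ}
    {c' : K.Chain ℤ k} (h : ∀ e, (c' e : ℚ) = m * c e) (hc : c ∈ K.chainsOn ℚ k P) :
    c' ∈ K.chainsOn ℤ k P := fun e he => by
  have := h e
  rw [hc e he, mul_zero] at this
  exact_mod_cast this

theorem boundary_cast (F : Type*) [CommRing F] (c : K.Chain ℤ (n + 1)) :
    K.boundary F n (fun e => (c e : F)) = fun j => ((K.boundary ℤ n c j : ℤ) : F) :=
  K.boundary_comp_map ℤ (Int.castRingHom F) n c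

/-- The columns of a basis of the matrix `D` of `∂` are a spanning tree. -/
theorem isSpanningTree_image [DecidableEq (K.cell (n + 1))] {σ : Fin R.r → K.cell (n + 1)}
    (hσ : (R.D.submatrix id σ).det ≠ 0) : K.IsSpanningTree (n + 1) (Finset.univ.image σ) := by
  constructor
  · refine ⟨fun x y => ?_⟩
    have : ∀ x : K.Homology ℤ (n + 1) (K.skeletonWith (n + 1) (Finset.univ.image σ)), x = 0 := by
      intro x
      obtain ⟨c, hc, rfl⟩ := K.exists_eq_relClass ℤ x
      have hc' := (K.mem_relCycles_noCells).1 hc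
      have h0 : c = 0 := by
        have h1 := columnInverse_mulVec_of_mem_chainsOn hσ (cast_mem_chainsOn (F := ℚ) hc'.1)
        have h2 : R.D *ᵥ (fun e => (c e : ℚ)) = 0 := by
          rw [R.D_mulVec_eq_zero_iff, ← boundary_eq_mulVec, boundary_cast]
          have h3 : K.boundary ℤ n c = 0 := hc'.2
          rw [h3]
          simp only [Pi.zero_apply, Int.cast_zero]
          rfl
        rw [h2, mulVec_zero] at h1
        funext e
        have h4 : (0 : ℚ) = c e := congrFun h1 e
        exact_mod_cast h4.symm
      rw [relClass_eq_zero_iff, h0]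
      exact zero_mem _
    rw [this x, this y]
  · intro m hm
    obtain rfl : m = n := by omega
    rw [betti_eq_iff _ (K.chainsOn_skeletonWith_of_lt ℚ (Nat.lt_succ_self m) _)]
    refine le_antisymm (fun _ ⟨c, _, hc⟩ => ⟨c, hc⟩) ?_
    rintro _ ⟨c, rfl⟩
    exact ⟨_, columnInverse_mem_chainsOn R.D σ _, boundary_columnInverse R hσ c⟩

/-- The columns of a basis of the matrix `N` of the quotient by the boundaries are a spanning
co-tree. -/
theorem isSpanningCotree_image {σ : Fin R.s → K.cell n}
    (hσ : (R.N.submatrix id σ).det ≠ 0) : K.IsSpanningCotree n (Finset.univ.image σ) := by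
  have hdecomp : ∀ c : K.Chain ℚ n, ∃ x, c = columnInverse R.N σ *ᵥ (R.N *ᵥ c) +
      K.boundary ℚ n x := by
    intro c
    refine ⟨R.Z *ᵥ (c - columnInverse R.N σ *ᵥ (R.N *ᵥ c)), ?_⟩
    rw [boundary_eq_mulVec, ← R.eq_of_N_mulVec_eq_zero, add_sub_cancel]
    rw [mulVec_sub, mulVec_mulVec _ R.N, mul_columnInverse hσ, one_mulVec, sub_self]
  refine ⟨⟨?_, ?_⟩, ?_⟩
  · rw [← LinearMap.ker_eq_bot, LinearMap.ker_eq_bot']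
    intro x hx
    obtain ⟨c, hc, rfl⟩ := K.exists_eq_relClass ℚ x
    have hc' := (K.mem_relCycles_noCells).1 hc
    rw [homologyToAll_relClass, relClass_eq_zero_iff, relBoundaries_noCells] at hx
    obtain ⟨y, -, hy⟩ := hx
    have h0 : c = 0 := by
      have h2 := columnInverse_mulVec_of_mem_chainsOn hσ hc'.1
      rw [← h2, ← hy, boundary_eq_mulVec, R.N_mulVec_mulVec, mulVec_zero]
    rw [relClass_eq_zero_iff, h0]
    exact zero_mem _
  · intro x
    obtain ⟨c, hc, rfl⟩ := K.exists_eq_relClass ℚ x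
    have hc' := (K.mem_relCycles_noCells).1 hc
    obtain ⟨y, hy⟩ := hdecomp c
    have hl : columnInverse R.N σ *ᵥ (R.N *ᵥ c) ∈
        K.relCycles ℚ n (K.skeletonWith n (Finset.univ.image σ)) K.noCells := by
      refine (K.mem_relCycles_noCells).2 ⟨columnInverse_mem_chainsOn _ _ _, ?_⟩
      have := congrArg (K.bdry ℚ n) hy
      rw [map_add, bdry_boundary, add_zero, hc'.2] at this
      exact this.symm
    refine ⟨K.relClass _ hl, ?_⟩
    rw [homologyToAll_relClass, ← sub_eq_zero, relClass_sub, relClass_eq_zero_iff,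
      relBoundaries_noCells, chainsOn_allCells]
    refine ⟨-y, Submodule.mem_top, ?_⟩
    have h : K.boundary ℚ n y = c - columnInverse R.N σ *ᵥ (R.N *ᵥ c) :=
      eq_sub_iff_add_eq'.2 hy.symm
    rw [map_neg, h, neg_sub]
  · intro m hm
    subst hm
    rw [betti_eq_iff _ (K.chainsOn_skeletonWith_of_lt ℚ (Nat.lt_succ_self m) _)]
    refine le_antisymm (fun _ ⟨c, _, hc⟩ => ⟨c, hc⟩) ?_
    rintro _ ⟨c, rfl⟩
    obtain ⟨y, hy⟩ := hdecomp c
    refine ⟨_, columnInverse_mem_chainsOn R.N σ (R.N *ᵥ c), ?_⟩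
    conv_rhs => rw [hy, map_add]
    have : K.boundary ℚ m (K.boundary ℚ (m + 1) y) = 0 := K.bdry_boundary ℚ (m + 1) y
    rw [this, add_zero]

/-- Modulo boundaries, every rational chain is supported on a given spanning co-tree. -/
theorem IsSpanningCotree.exists_add_boundary {L : Finset (K.cell n)}
    (hL : K.IsSpanningCotree n L) (c : K.Chain ℚ n) :
    ∃ l ∈ K.chainsOn ℚ n (K.skeletonWith n L), ∃ x, c = l + K.boundary ℚ n x := by
  have hcycle : ∀ c : K.Chain ℚ n, K.bdry ℚ n c = 0 →
      ∃ l ∈ K.chainsOn ℚ n (K.skeletonWith n L), ∃ x, c = l + K.boundary ℚ n x := by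
    intro c hc
    have hmem : c ∈ K.relCycles ℚ n K.allCells K.noCells :=
      (K.mem_relCycles_noCells).2 ⟨by rw [chainsOn_allCells]; trivial, hc⟩
    obtain ⟨y, hy⟩ := hL.1.2 (K.relClass c hmem)
    obtain ⟨l, hl, rfl⟩ := K.exists_eq_relClass ℚ y
    rw [homologyToAll_relClass, ← sub_eq_zero, relClass_sub, relClass_eq_zero_iff,
      relBoundaries_noCells] at hy
    obtain ⟨x, -, hx⟩ := hy
    refine ⟨l, ((K.mem_relCycles_noCells).1 hl).1, -x, ?_⟩
    rw [map_neg, hx]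
    abel
  cases n with
  | zero => exact hcycle c rfl
  | succ m =>
    have h1 := (betti_eq_iff _ (K.chainsOn_skeletonWith_of_lt ℚ (Nat.lt_succ_self m) _)).1
      (hL.2 m rfl)
    have h2 : K.boundary ℚ m c ∈ LinearMap.range (K.boundary ℚ m) := ⟨c, rfl⟩
    rw [← h1] at h2
    obtain ⟨l, hl, hlc⟩ := h2
    obtain ⟨l', hl', x, hx⟩ := hcycle (c - l) (by
      change K.boundary ℚ m (c - l) = 0
      rw [map_sub, hlc, sub_self])
    refine ⟨l + l', add_mem hl hl', x, ?_⟩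
    rw [add_assoc, ← hx, add_sub_cancel]

theorem IsSpanningCotree.cotreeIndex_pos {L : Finset (K.cell n)}
    (hL : K.IsSpanningCotree n L) : 0 < K.cotreeIndex n L := by
  have hfin : Finite (K.RelHomology ℤ n K.allCells (K.skeletonWith n L)) := by
    refine Module.finite_of_fg_torsion _ fun {y} => ?_
    obtain ⟨c, hc, rfl⟩ := K.exists_eq_relClass ℤ y
    obtain ⟨l, hl, x, hx⟩ := hL.exists_add_boundary fun e => (c e : ℚ)
    obtain ⟨m, hm, g, hg⟩ := exists_int_multiple (Sum.elim l x)
    refine ⟨⟨m, mem_nonZeroDivisors_of_ne_zero hm⟩, ?_⟩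
    rw [Submonoid.mk_smul, smul_relClass, relClass_eq_zero_iff]
    have h1 : m • c = g ∘ Sum.inl + K.boundary ℤ n (g ∘ Sum.inr) := by
      have h2 : K.boundary ℚ n (fun e => ((g ∘ Sum.inr) e : ℚ)) = m • K.boundary ℚ n x := by
        rw [← map_zsmul]
        congr 1
        funext e
        simpa using hg (Sum.inr e)
      rw [boundary_cast] at h2
      funext j
      have h3 := congrFun h2 j
      have h4 := congrFun hx j
      have h5 := hg (Sum.inl j)
      have : ((m • c) j : ℚ) = ((g ∘ Sum.inl + K.boundary ℤ n (g ∘ Sum.inr)) j : ℤ) := by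
        simp only [Pi.smul_apply, Pi.add_apply, smul_eq_mul, Function.comp_apply] at *
        push_cast
        rw [h5, h3, h4]
        simp [mul_add]
      exact_mod_cast this
    rw [h1]
    refine Submodule.add_mem_sup ?_ ⟨_, by rw [chainsOn_allCells]; trivial, rfl⟩
    exact mem_chainsOn_of_cast (fun e => hg (Sum.inl e)) hl
  rw [cotreeIndex]
  exact Nat.card_pos

variable (K) in
theorem treeTorsion_pos (T : Finset (K.cell (n + 1))) : 0 < K.treeTorsion n T := by
  have : Finite (Submodule.torsion ℤ (K.Homology ℤ n (K.skeletonWith (n + 1) T))) :=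
    Module.finite_of_fg_torsion _ Submodule.torsion_isTorsion
  rw [treeTorsion]
  exact Nat.card_pos

variable (K n) in
theorem delta_pos : 0 < K.delta n := by
  classical
  refine Finset.prod_pos fun L hL => Finset.prod_pos fun T _ => ?_
  exact Nat.mul_pos (Finset.mem_filter.1 hL).2.cotreeIndex_pos (K.treeTorsion_pos T)

theorem dvd_delta {L : Finset (K.cell n)} {T : Finset (K.cell (n + 1))}
    (hL : K.IsSpanningCotree n L) (hT : K.IsSpanningTree (n + 1) T) :
    K.cotreeIndex n L * K.treeTorsion n T ∣ K.delta n := by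
  classical
  rw [delta]
  refine dvd_trans ?_ (Finset.dvd_prod_of_mem _ (Finset.mem_filter.2 ⟨Finset.mem_univ L, hL⟩))
  exact Finset.dvd_prod_of_mem (fun T => K.cotreeIndex n L * K.treeTorsion n T)
    (Finset.mem_filter.2 ⟨Finset.mem_univ T, hT⟩)

/-- A cycle becomes homologous to a chain on `L` when it is multiplied by the order of
`H_n(X, L; ℤ)`. -/
theorem exists_cotreeIndex_smul_eq (L : Finset (K.cell n)) {z : K.Chain ℤ n}
    (hz : K.bdry ℤ n z = 0) :
    ∃ l ∈ K.chainsOn ℤ n (K.skeletonWith n L), ∃ x,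
      K.cotreeIndex n L • z = l + K.boundary ℤ n x := by
  have hmem : z ∈ K.relCycles ℤ n K.allCells (K.skeletonWith n L) := by
    refine ⟨by rw [chainsOn_allCells]; trivial, ?_⟩
    rw [SetLike.mem_coe, Submodule.mem_comap, hz]
    exact zero_mem _
  have h2 : K.cotreeIndex n L • K.relClass z hmem = 0 := card_nsmul_eq_zero'
  rw [nsmul_relClass, relClass_eq_zero_iff] at h2
  obtain ⟨l, hl, _, ⟨x, -, rfl⟩, h⟩ := Submodule.mem_sup.1 h2
  exact ⟨l, hl, x, h.symm⟩

/-- An integral boundary bounds an integral chain on a spanning tree `T` when it is multiplied by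
the order of the torsion of `H_n(T; ℤ)`. -/
theorem exists_boundary_eq_treeTorsion_smul [DecidableEq (K.cell (n + 1))]
    {σ : Fin R.r → K.cell (n + 1)} (hσ : (R.D.submatrix id σ).det ≠ 0) (y : K.Chain ℤ (n + 1)) :
    ∃ x ∈ K.chainsOn ℤ (n + 1) (K.skeletonWith (n + 1) (Finset.univ.image σ)),
      K.boundary ℤ n x = K.treeTorsion n (Finset.univ.image σ) • K.boundary ℤ n y := by
  set T := Finset.univ.image σ with hT
  set b := K.boundary ℤ n y with hb
  have hmem : b ∈ K.relCycles ℤ n (K.skeletonWith (n + 1) T) K.noCells :=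
    (K.mem_relCycles_noCells).2
      ⟨by rw [K.chainsOn_skeletonWith_of_lt ℤ (Nat.lt_succ_self n)]; trivial,
        K.bdry_boundary ℤ n y⟩
  have htors : K.relClass b hmem ∈
      Submodule.torsion ℤ (K.Homology ℤ n (K.skeletonWith (n + 1) T)) := by
    obtain ⟨m, hm, g, hg⟩ := exists_int_multiple
      (columnInverse R.D σ *ᵥ (R.D *ᵥ fun e => (y e : ℚ)))
    rw [Submodule.mem_torsion_iff]
    refine ⟨⟨m, mem_nonZeroDivisors_of_ne_zero hm⟩, ?_⟩
    rw [Submonoid.mk_smul, smul_relClass, relClass_eq_zero_iff, relBoundaries_noCells]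
    refine ⟨g, mem_chainsOn_of_cast hg (columnInverse_mem_chainsOn R.D σ _), ?_⟩
    have h1 : (fun e => (g e : ℚ)) =
        m • (columnInverse R.D σ *ᵥ (R.D *ᵥ fun e => (y e : ℚ))) := by
      funext e
      simpa using hg e
    have h2 := congrArg (K.boundary ℚ n) h1
    rw [map_zsmul, boundary_columnInverse R hσ, boundary_cast, boundary_cast] at h2
    funext j
    have h3 := congrFun h2 j
    simp only [Pi.smul_apply, zsmul_eq_mul] at h3
    rw [Pi.smul_apply, smul_eq_mul]
    exact_mod_cast h3
  have h1 : K.treeTorsion n T • (⟨_, htors⟩ :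
      Submodule.torsion ℤ (K.Homology ℤ n (K.skeletonWith (n + 1) T))) = 0 := card_nsmul_eq_zero'
  have h2 : K.treeTorsion n T • K.relClass b hmem = 0 := congrArg Subtype.val h1
  rw [nsmul_relClass, relClass_eq_zero_iff, relBoundaries_noCells] at h2
  obtain ⟨x, hx, h⟩ := h2
  exact ⟨x, hx, h⟩

end Trees

end BasedComplex

/-! ### The right inverse weighted by a Gibbs distribution -/

namespace Matrix

variable {κ ι : Type*} [Fintype κ] [DecidableEq κ] [Fintype ι] [DecidableEq ι]
  (M : Matrix κ ι ℝ)

/-- The multiplicity of a basis of columns. -/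
noncomputable def columnMultiplicity (σ : ColumnBasis M) : ℝ := (M.submatrix id σ.1).det ^ 2

/-- The energy of a basis of columns. -/
def columnEnergy (U : ι → ℝ) (σ : ColumnBasis M) : ℝ := ∑ i, U (σ.1 i)

/-- The average of the right inverses `columnInverse M σ` over the Gibbs distribution. -/
noncomputable def gibbsInverse (β : ℝ) (U : ι → ℝ) : Matrix ι κ ℝ :=
  ∑ σ : ColumnBasis M, gibbs (columnMultiplicity M) β (columnEnergy M U) σ • columnInverse M σ.1

theorem columnMultiplicity_pos (σ : ColumnBasis M) : 0 < columnMultiplicity M σ :=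
  Even.pow_pos even_two σ.2

variable (β : ℝ) (U : ι → ℝ)

theorem mul_gibbsInverse [Nonempty (ColumnBasis M)] : M * gibbsInverse M β U = 1 := by
  rw [gibbsInverse, Matrix.mul_sum]
  have : ∀ σ : ColumnBasis M, M * (gibbs (columnMultiplicity M) β (columnEnergy M U) σ •
      columnInverse M σ.1) =
      gibbs (columnMultiplicity M) β (columnEnergy M U) σ • (1 : Matrix κ κ ℝ) := by
    intro σ
    rw [Matrix.mul_smul, mul_columnInverse σ.2]
  simp only [this]
  rw [← Finset.sum_smul, sum_gibbs (columnMultiplicity_pos M), one_smul]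

theorem gibbsInverse_mulVec_apply (b : κ → ℝ) (α : ι) :
    (gibbsInverse M β U *ᵥ b) α = ∑ σ : ColumnBasis M,
      gibbs (columnMultiplicity M) β (columnEnergy M U) σ * (columnInverse M σ.1 *ᵥ b) α := by
  rw [gibbsInverse, sum_mulVec, Finset.sum_apply]
  refine Finset.sum_congr rfl fun σ _ => ?_
  rw [smul_mulVec, Pi.smul_apply, smul_eq_mul]

theorem gibbsInverse_orthogonal {y : ι → ℝ} (hy : M *ᵥ y = 0) (b : κ → ℝ) :
    ∑ α, y α / Real.exp (-(β * U α)) * (gibbsInverse M β U *ᵥ b) α = 0 := by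
  have h := sum_div_mul_columnInverse_eq_zero M (w := fun α => Real.exp (-(β * U α)))
    (fun α => (Real.exp_pos _).ne') hy b
  have hexp : ∀ σ : ColumnBasis M, ∏ i, Real.exp (-(β * U (σ.1 i))) =
      Real.exp (-(β * columnEnergy M U σ)) := by
    intro σ
    rw [← Real.exp_sum, columnEnergy, Finset.mul_sum, Finset.sum_neg_distrib]
  simp only [hexp] at h
  set Z := ∑ σ, columnMultiplicity M σ * Real.exp (-(β * columnEnergy M U σ)) with hZ
  rw [← mul_zero Z⁻¹, ← h, Finset.mul_sum]
  refine Finset.sum_congr rfl fun α _ => ?_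
  rw [gibbsInverse_mulVec_apply, mul_left_comm]
  congr 1
  rw [Finset.mul_sum]
  refine Finset.sum_congr rfl fun σ _ => ?_
  rw [gibbs, ← hZ, columnMultiplicity]
  ring

end Matrix

/-! ### Relaxation of the dynamics to the Boltzmann distribution -/

/-- A periodic curve with continuous derivative `E'`. -/
structure IsPeriodicC1 {V : Type*} [NormedAddCommGroup V] [NormedSpace ℝ V] (E E' : ℝ → V) :
    Prop where
  hasDerivAt : ∀ t, HasDerivAt E (E' t) t
  continuous_deriv : Continuous E'
  periodic : Function.Periodic E 1
  periodic_deriv : Function.Periodic E' 1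

theorem IsPeriodicC1.continuous {V : Type*} [NormedAddCommGroup V] [NormedSpace ℝ V]
    {E E' : ℝ → V} (h : IsPeriodicC1 E E') : Continuous E :=
  continuous_iff_continuousAt.2 fun t => (h.hasDerivAt t).continuousAt

theorem ContDiff.isPeriodicC1 {V : Type*} [NormedAddCommGroup V] [NormedSpace ℝ V]
    {E : ℝ → V} (h : ContDiff ℝ ∞ E) (hper : Function.Periodic E 1) : IsPeriodicC1 E (deriv E) where
  hasDerivAt t := (h.differentiable (by simp) t).hasDerivAt
  continuous_deriv := h.continuous_deriv (by simp)
  periodic := hper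
  periodic_deriv t := by
    rw [← deriv_comp_add_const]
    congr 1
    exact funext hper

theorem exists_abs_le_of_periodic {ι : Type*} [Fintype ι] {f : ℝ → ι → ℝ} (hf : Continuous f)
    (hper : Function.Periodic f 1) : ∃ K, 0 ≤ K ∧ ∀ t i, |f t i| ≤ K := by
  obtain ⟨K, hK0, hK⟩ := exists_norm_le_of_periodic hf hper
  exact ⟨K, hK0, fun t i => (norm_le_pi_norm (f t) i).trans (hK t)⟩

namespace BasedComplex

open Matrix

variable {K : BasedComplex.{u}} {n : ℕ} [DecidableEq (K.cell n)]

theorem boundary_apply (c : K.Chain ℝ (n + 1)) (j : K.cell n) :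
    K.boundary ℝ n c j = ∑ α, c α * (K.inc n α j : ℝ) := rfl

variable (R : RankFactorization (K.boundaryMatrix ℝ n))

theorem mem_range_boundary_iff {c : K.Chain ℝ n} :
    c ∈ LinearMap.range (K.boundary ℝ n) ↔ R.N *ᵥ c = 0 := by
  constructor
  · rintro ⟨x, rfl⟩
    rw [boundary_eq_mulVec, R.N_mulVec_mulVec]
  · intro h
    exact ⟨R.Z *ᵥ c, by rw [boundary_eq_mulVec, ← R.eq_of_N_mulVec_eq_zero h]⟩

theorem N_mulVec_dynamicalOperator (β : ℝ) (E : K.cell n → ℝ) (W : K.cell (n + 1) → ℝ)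
    (c : K.Chain ℝ n) : R.N *ᵥ K.dynamicalOperator n β E W c = 0 :=
  (mem_range_boundary_iff R).1 ⟨_, rfl⟩

/-- The biased coboundary takes values in the orthogonal complement of the cycles for the inner
product weighted by `e^{βW}`. -/
theorem biasedCoboundary_orthogonal (β : ℝ) (E : K.cell n → ℝ) (W : K.cell (n + 1) → ℝ)
    (c : K.Chain ℝ n) {y : K.Chain ℝ (n + 1)} (hy : K.boundary ℝ n y = 0) :
    ∑ α, y α / Real.exp (-(β * W α)) * K.biasedCoboundary n β E W c α = 0 := by
  have h1 : ∀ α, y α / Real.exp (-(β * W α)) * K.biasedCoboundary n β E W c α =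
      ∑ j, y α * (K.inc n α j : ℝ) * (Real.exp (β * E j) * c j) := by
    intro α
    have := (Real.exp_pos (-(β * W α))).ne'
    simp only [biasedCoboundary, mul_assoc (y α), ← Finset.mul_sum]
    field_simp
  simp only [h1]
  rw [Finset.sum_comm]
  refine Finset.sum_eq_zero fun j _ => ?_
  rw [← Finset.sum_mul, ← boundary_apply, hy, Pi.zero_apply, zero_mul]

/-- The Boltzmann distribution: the chain homologous to `z` in the kernel of the dynamical
operator. -/
noncomputable def boltzmann (β : ℝ) (E : K.cell n → ℝ) (z : K.Chain ℝ n) : K.Chain ℝ n :=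
  gibbsInverse R.N β E *ᵥ (R.N *ᵥ z)

theorem nonempty_columnBasis_N : Nonempty (ColumnBasis R.N) :=
  let ⟨σ, h⟩ := exists_det_submatrix_ne_zero R.mul_Y
  ⟨⟨σ, h⟩⟩

theorem nonempty_columnBasis_D [DecidableEq (K.cell (n + 1))] : Nonempty (ColumnBasis R.D) :=
  let ⟨σ, h⟩ := exists_det_submatrix_ne_zero R.mul_X
  ⟨⟨σ, h⟩⟩

theorem N_mulVec_boltzmann (β : ℝ) (E : K.cell n → ℝ) (z : K.Chain ℝ n) :
    R.N *ᵥ boltzmann R β E z = R.N *ᵥ z := by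
  have := nonempty_columnBasis_N R
  rw [boltzmann, mulVec_mulVec, mul_gibbsInverse, one_mulVec]

theorem biasedCoboundary_boltzmann (β : ℝ) (E : K.cell n → ℝ) (W : K.cell (n + 1) → ℝ)
    (z : K.Chain ℝ n) : K.biasedCoboundary n β E W (boltzmann R β E z) = 0 := by
  classical
  funext α
  have hy : R.N *ᵥ (fun j => (K.inc n α j : ℝ)) = 0 := by
    refine (mem_range_boundary_iff R).1 ⟨Pi.single α 1, ?_⟩
    funext j
    simp [boundary_apply, Pi.single_apply]
  have h := gibbsInverse_orthogonal R.N β E hy (R.N *ᵥ z)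
  have h2 : ∑ j, (K.inc n α j : ℝ) * (Real.exp (β * E j) * boltzmann R β E z j) = 0 := by
    rw [← h]
    refine Finset.sum_congr rfl fun j _ => ?_
    rw [boltzmann, Real.exp_neg, div_inv_eq_mul, mul_assoc]
  simp only [biasedCoboundary, h2, mul_zero, Pi.zero_apply]

theorem dynamicalOperator_boltzmann (β : ℝ) (E : K.cell n → ℝ) (W : K.cell (n + 1) → ℝ)
    (z : K.Chain ℝ n) : K.dynamicalOperator n β E W (boltzmann R β E z) = 0 := by
  rw [dynamicalOperator, biasedCoboundary_boltzmann, map_zero]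

theorem biasedCoboundary_sub (β : ℝ) (E : K.cell n → ℝ) (W : K.cell (n + 1) → ℝ)
    (c c' : K.Chain ℝ n) : K.biasedCoboundary n β E W (c - c') =
      K.biasedCoboundary n β E W c - K.biasedCoboundary n β E W c' := by
  funext α
  simp only [biasedCoboundary, Pi.sub_apply, mul_sub, Finset.sum_sub_distrib]

theorem dynamicalOperator_sub (β : ℝ) (E : K.cell n → ℝ) (W : K.cell (n + 1) → ℝ)
    (c c' : K.Chain ℝ n) : K.dynamicalOperator n β E W (c - c') =
      K.dynamicalOperator n β E W c - K.dynamicalOperator n β E W c' := by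
  rw [dynamicalOperator, biasedCoboundary_sub, map_sub]; rfl

/-- The dynamical operator as a continuous linear map. -/
noncomputable def dynamicalCLM (n : ℕ) (β : ℝ) (E : K.cell n → ℝ) (W : K.cell (n + 1) → ℝ) :
    K.Chain ℝ n →L[ℝ] K.Chain ℝ n :=
  LinearMap.toContinuousLinearMap
    { toFun := K.dynamicalOperator n β E W
      map_add' := fun c c' => by
        have h1 : K.biasedCoboundary n β E W (c + c') =
            K.biasedCoboundary n β E W c + K.biasedCoboundary n β E W c' := by
          funext α
          simp only [biasedCoboundary, Pi.add_apply, mul_add, Finset.sum_add_distrib]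
        rw [dynamicalOperator, h1, map_add]; rfl
      map_smul' := fun a c => by
        have h1 : K.biasedCoboundary n β E W (a • c) = a • K.biasedCoboundary n β E W c := by
          funext α
          simp only [biasedCoboundary, Pi.smul_apply, smul_eq_mul, Finset.mul_sum]
          exact Finset.sum_congr rfl fun j _ => by ring
        rw [dynamicalOperator, h1, map_smul]; rfl }

theorem dynamicalCLM_apply (β : ℝ) (E : K.cell n → ℝ) (W : K.cell (n + 1) → ℝ)
    (c : K.Chain ℝ n) : dynamicalCLM n β E W c = K.dynamicalOperator n β E W c := rfl

theorem continuous_biasedCoboundary {E : ℝ → K.cell n → ℝ} {W : ℝ → K.cell (n + 1) → ℝ}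
    {c : ℝ → K.Chain ℝ n} (hE : Continuous E) (hW : Continuous W) (hc : Continuous c) (β : ℝ) :
    Continuous fun t => K.biasedCoboundary n β (E t) (W t) (c t) := by
  refine continuous_pi fun α => ?_
  simp only [biasedCoboundary]
  fun_prop

theorem continuous_dynamicalCLM {E : ℝ → K.cell n → ℝ} {W : ℝ → K.cell (n + 1) → ℝ}
    (hE : Continuous E) (hW : Continuous W) (β : ℝ) :
    Continuous fun t => dynamicalCLM n β (E t) (W t) := by
  refine continuous_clm_apply.2 fun c => ?_
  have h := continuous_biasedCoboundary hE hW (continuous_const (y := c)) β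
  simp only [dynamicalCLM_apply, dynamicalOperator]
  exact (LinearMap.continuous_of_finiteDimensional _).comp h

/-- For the inner product weighted by `e`, the operator `∂ w ∂* e` on boundaries is the Gram
operator of `∂* e`. -/
theorem sum_mul_mul_dynamicalOperator (β : ℝ) (E : K.cell n → ℝ) (W : K.cell (n + 1) → ℝ)
    (c : K.Chain ℝ n) :
    ∑ j, Real.exp (β * E j) * c j * K.dynamicalOperator n β E W c j =
      ∑ α, Real.exp (-(β * W α)) * (∑ j, (K.inc n α j : ℝ) * (Real.exp (β * E j) * c j)) ^ 2 := by
  simp only [dynamicalOperator, boundary_apply, Finset.mul_sum]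
  rw [Finset.sum_comm]
  refine Finset.sum_congr rfl fun α _ => ?_
  rw [sq, Finset.mul_sum, Finset.mul_sum]
  refine Finset.sum_congr rfl fun j _ => ?_
  simp only [biasedCoboundary]
  ring

/-- A spectral gap on the boundaries, uniform in the weights. -/
theorem exists_spectral_gap {m : ℝ} (hm : 0 < m) : ∃ l > 0, ∀ (e : K.cell n → ℝ)
    (w : K.cell (n + 1) → ℝ), (∀ j, m ≤ e j) → (∀ α, m ≤ w α) → ∀ c : K.Chain ℝ n,
    R.N *ᵥ c = 0 → l * ∑ j, e j * c j ^ 2 ≤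
      ∑ α, w α * (∑ j, (K.inc n α j : ℝ) * (e j * c j)) ^ 2 := by
  set C := ∑ α, ∑ j, R.Z α j ^ 2 with hC
  have hC0 : 0 ≤ C := Finset.sum_nonneg fun _ _ => Finset.sum_nonneg fun _ _ => sq_nonneg _
  refine ⟨m ^ 2 / (C + 1), by positivity, fun e w he hw c hc => ?_⟩
  set x := R.Z *ᵥ c with hx
  set g := fun α => ∑ j, (K.inc n α j : ℝ) * (e j * c j) with hg
  set f := ∑ j, e j * c j ^ 2 with hf
  set q := ∑ α, w α * g α ^ 2 with hq
  have hcx : c = K.boundary ℝ n x := by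
    rw [boundary_eq_mulVec]; exact R.eq_of_N_mulVec_eq_zero hc
  have hf0 : 0 ≤ f := Finset.sum_nonneg fun j _ => mul_nonneg (hm.le.trans (he j)) (sq_nonneg _)
  have hq0 : 0 ≤ q := Finset.sum_nonneg fun j _ => mul_nonneg (hm.le.trans (hw j)) (sq_nonneg _)
  have h1 : f = ∑ α, x α * g α := by
    have : f = ∑ j, e j * c j * K.boundary ℝ n x j := by
      rw [← hcx]
      exact Finset.sum_congr rfl fun j _ => by ring
    rw [this]
    simp only [boundary_apply, Finset.mul_sum, hg]
    rw [Finset.sum_comm]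
    exact Finset.sum_congr rfl fun α _ => Finset.sum_congr rfl fun j _ => by ring
  have h2 : f ^ 2 ≤ (∑ α, x α ^ 2) * ∑ α, g α ^ 2 := by
    rw [h1]; exact Finset.sum_mul_sq_le_sq_mul_sq _ _ _
  have h3 : ∑ α, x α ^ 2 ≤ C * ∑ j, c j ^ 2 := by
    rw [hC, Finset.sum_mul]
    exact Finset.sum_le_sum fun α _ => Finset.sum_mul_sq_le_sq_mul_sq _ _ _
  have h4 : m * ∑ j, c j ^ 2 ≤ f := by
    rw [Finset.mul_sum]
    exact Finset.sum_le_sum fun j _ => mul_le_mul_of_nonneg_right (he j) (sq_nonneg _)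
  have h5 : m * ∑ α, g α ^ 2 ≤ q := by
    rw [Finset.mul_sum]
    exact Finset.sum_le_sum fun j _ => mul_le_mul_of_nonneg_right (hw j) (sq_nonneg _)
  have hc0 : 0 ≤ ∑ j, c j ^ 2 := Finset.sum_nonneg fun _ _ => sq_nonneg _
  have hg0 : 0 ≤ ∑ α, g α ^ 2 := Finset.sum_nonneg fun _ _ => sq_nonneg _
  have h6 : m ^ 2 * f ^ 2 ≤ C * f * q := by
    calc m ^ 2 * f ^ 2 ≤ m ^ 2 * ((C * ∑ j, c j ^ 2) * ∑ α, g α ^ 2) := by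
          gcongr
          exact h2.trans (mul_le_mul_of_nonneg_right h3 hg0)
      _ = C * (m * ∑ j, c j ^ 2) * (m * ∑ α, g α ^ 2) := by ring
      _ ≤ C * f * q := by gcongr
  rw [div_mul_eq_mul_div, div_le_iff₀ (by positivity)]
  rcases hf0.eq_or_lt with h0 | h0
  · rw [← h0, mul_zero]; positivity
  · have h7 : f * (m ^ 2 * f) ≤ f * (q * (C + 1)) := by nlinarith [mul_nonneg hf0 hq0]
    exact le_of_mul_le_mul_left h7 h0

variable {E E' : ℝ → K.cell n → ℝ} {W W' : ℝ → K.cell (n + 1) → ℝ}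

/-- The energy estimate: a periodic solution of the forced equation that consists of boundaries is
of order `τ^{-1/2}`. At a time when `∑ e^{βE} u²` is maximal its derivative vanishes, and the
dissipation is bounded by the other terms. -/
theorem exists_energy_bound (hE : IsPeriodicC1 E E') (hW : IsPeriodicC1 W W') (β : ℝ) :
    ∃ l > 0, ∃ k > 0, ∀ (τ G : ℝ) (u g : ℝ → K.Chain ℝ n), 0 ≤ τ → 0 ≤ l * τ - k →
      Function.Periodic u 1 →
      (∀ t, HasDerivAt u (-(τ • K.dynamicalOperator n β (E t) (W t) (u t)) - g t) t) →
      (∀ t, R.N *ᵥ u t = 0) → (∀ t, ∑ j, Real.exp (β * E t j) * g t j ^ 2 ≤ G) →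
      ∀ t j, (l * τ - k) * u t j ^ 2 ≤ G := by
  obtain ⟨ME, hME0, hME⟩ := exists_abs_le_of_periodic hE.continuous hE.periodic
  obtain ⟨MW, hMW0, hMW⟩ := exists_abs_le_of_periodic hW.continuous hW.periodic
  obtain ⟨κ, hκ0, hκ⟩ := exists_abs_le_of_periodic hE.continuous_deriv hE.periodic_deriv
  set m := Real.exp (-(|β| * (ME + MW))) with hm
  have hm0 : 0 < m := Real.exp_pos _
  have hmE : ∀ t j, m ≤ Real.exp (β * E t j) := by
    intro t j
    refine Real.exp_le_exp.2 ?_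
    have h1 : |β * E t j| ≤ |β| * (ME + MW) := by
      rw [abs_mul]
      exact mul_le_mul_of_nonneg_left (by linarith [hME t j]) (abs_nonneg _)
    exact (neg_le_neg h1).trans (neg_abs_le _)
  have hmW : ∀ t α, m ≤ Real.exp (-(β * W t α)) := by
    intro t j
    refine Real.exp_le_exp.2 (neg_le_neg ?_)
    have h1 : |β * W t j| ≤ |β| * (ME + MW) := by
      rw [abs_mul]
      exact mul_le_mul_of_nonneg_left (by linarith [hMW t j]) (abs_nonneg _)
    exact (le_abs_self _).trans h1
  obtain ⟨l, hl, hgap⟩ := exists_spectral_gap R hm0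
  refine ⟨2 * l * m, by positivity, m * (|β| * κ + 1), by positivity, ?_⟩
  intro τ G u g hτ hpos hper hu hN hG
  set f : ℝ → ℝ := fun t => ∑ j, Real.exp (β * E t j) * u t j ^ 2 with hf
  have huj : ∀ t j, HasDerivAt (fun t => u t j)
      (-(τ * K.dynamicalOperator n β (E t) (W t) (u t) j) - g t j) t := fun t j =>
    (hasDerivAt_pi.1 (hu t)) j
  have hfd : ∀ t, HasDerivAt f (∑ j, (Real.exp (β * E t j) * (β * E' t j) * u t j ^ 2 +
      Real.exp (β * E t j) * (2 * u t j *
        (-(τ * K.dynamicalOperator n β (E t) (W t) (u t) j) - g t j)))) t := by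
    intro t
    refine HasDerivAt.fun_sum fun j _ => ?_
    have h1 := ((((hasDerivAt_pi.1 (hE.hasDerivAt t)) j).const_mul β).exp).mul ((huj t j).pow 2)
    refine h1.congr_deriv ?_
    simp
  have hfc : Continuous f := continuous_iff_continuousAt.2 fun t => (hfd t).continuousAt
  have hfper : Function.Periodic f 1 := fun t => by
    simp only [hf]
    rw [hE.periodic t, hper t]
  obtain ⟨s, -, hs⟩ := isCompact_Icc.exists_isMaxOn (s := Set.Icc (0 : ℝ) 1)
    ⟨0, le_rfl, zero_le_one⟩ hfc.continuousOn
  have hmax : ∀ t, f t ≤ f s := by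
    intro t
    obtain ⟨t', ht', h⟩ := hfper.exists_mem_Ico₀ one_pos t
    rw [h]
    exact hs ⟨ht'.1, ht'.2.le⟩
  have hzero := IsLocalMax.hasDerivAt_eq_zero (Eventually.of_forall hmax) (hfd s)
  set q := ∑ α, Real.exp (-(β * W s α)) *
    (∑ j, (K.inc n α j : ℝ) * (Real.exp (β * E s j) * u s j)) ^ 2 with hq
  have hlq : l * f s ≤ q := hgap _ _ (hmE s) (hmW s) (u s) (hN s)
  have hsplit : ∑ j, Real.exp (β * E s j) * (β * E' s j) * u s j ^ 2 - 2 * τ * q -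
      ∑ j, Real.exp (β * E s j) * (2 * u s j * g s j) = 0 := by
    rw [← hzero, hq, ← sum_mul_mul_dynamicalOperator, Finset.mul_sum, ← Finset.sum_sub_distrib,
      ← Finset.sum_sub_distrib]
    exact Finset.sum_congr rfl fun j _ => by ring
  have h1 : ∑ j, Real.exp (β * E s j) * (β * E' s j) * u s j ^ 2 ≤ |β| * κ * f s := by
    rw [hf, Finset.mul_sum]
    refine Finset.sum_le_sum fun j _ => ?_
    have h2 : β * E' s j ≤ |β| * κ := by
      refine (le_abs_self _).trans ?_
      rw [abs_mul]
      exact mul_le_mul_of_nonneg_left (hκ s j) (abs_nonneg _)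
    have h3 : 0 ≤ Real.exp (β * E s j) * u s j ^ 2 := by positivity
    nlinarith
  have h2 : -∑ j, Real.exp (β * E s j) * (2 * u s j * g s j) ≤ f s + G := by
    refine le_trans ?_ (add_le_add_right (hG s) _)
    rw [hf, ← Finset.sum_add_distrib, ← Finset.sum_neg_distrib]
    refine Finset.sum_le_sum fun j _ => ?_
    nlinarith [mul_nonneg (Real.exp_pos (β * E s j)).le (sq_nonneg (u s j + g s j))]
  have h3 : (2 * l * τ - (|β| * κ + 1)) * f s ≤ G := by
    nlinarith [mul_le_mul_of_nonneg_left hlq hτ]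
  intro t j
  have h4 : m * u t j ^ 2 ≤ f t := by
    refine le_trans (mul_le_mul_of_nonneg_right (hmE t j) (sq_nonneg _)) ?_
    exact Finset.single_le_sum (f := fun j => Real.exp (β * E t j) * u t j ^ 2)
      (fun i _ => by positivity) (Finset.mem_univ j)
  have h5 : 0 ≤ 2 * l * τ - (|β| * κ + 1) := by
    have : 0 ≤ m * (2 * l * τ - (|β| * κ + 1)) := by linarith
    exact nonneg_of_mul_nonneg_right this hm0
  calc (2 * l * m * τ - m * (|β| * κ + 1)) * u t j ^ 2
      = (2 * l * τ - (|β| * κ + 1)) * (m * u t j ^ 2) := by ring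
    _ ≤ (2 * l * τ - (|β| * κ + 1)) * f s :=
        mul_le_mul_of_nonneg_left (h4.trans (hmax t)) h5
    _ ≤ G := h3

end BasedComplex

namespace BasedComplex

open Matrix

variable {K : BasedComplex.{u}} {n : ℕ} [DecidableEq (K.cell n)]
  (R : RankFactorization (K.boundaryMatrix ℝ n))
  {E E' : ℝ → K.cell n → ℝ} {W W' : ℝ → K.cell (n + 1) → ℝ} {z : K.Chain ℤ n} {β τ : ℝ}
  {ρ : ℝ → K.Chain ℝ n}

theorem hasDerivAt_mulVec {p q : Type*} [Fintype p] [Fintype q] (M : Matrix q p ℝ)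
    {u : ℝ → p → ℝ} {u' : p → ℝ} {t : ℝ} (hu : HasDerivAt u u' t) :
    HasDerivAt (fun t => M *ᵥ u t) (M *ᵥ u') t := by
  refine hasDerivAt_pi.2 fun i => ?_
  exact HasDerivAt.fun_sum fun j _ => ((hasDerivAt_pi.1 hu) j).const_mul _

theorem N_mulVec_eq_of_hasDerivAt {u : ℝ → K.Chain ℝ n}
    (hu : ∀ t, HasDerivAt u (-(τ • K.dynamicalOperator n β (E t) (W t) (u t))) t) (t : ℝ) :
    R.N *ᵥ u t = R.N *ᵥ u 0 := by
  have h : ∀ t, HasDerivAt (fun t => R.N *ᵥ u t) 0 t := by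
    intro t
    have := hasDerivAt_mulVec R.N (hu t)
    rwa [mulVec_neg, mulVec_smul, N_mulVec_dynamicalOperator, smul_zero, neg_zero] at this
  exact is_const_of_deriv_eq_zero (fun t => (h t).differentiableAt) (fun t => (h t).deriv) t 0

theorem IsPeriodicSolution.N_mulVec (h : IsPeriodicSolution E W z β τ ρ) (t : ℝ) :
    R.N *ᵥ ρ t = R.N *ᵥ fun j => (z j : ℝ) := by
  rw [N_mulVec_eq_of_hasDerivAt R h.hasDerivAt t, ← sub_eq_zero, ← mulVec_sub]
  exact (mem_range_boundary_iff R).1 h.homologous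

theorem IsPeriodicSolution.continuous (h : IsPeriodicSolution E W z β τ ρ) : Continuous ρ :=
  continuous_iff_continuousAt.2 fun t => (h.hasDerivAt t).continuousAt

include R in
/-- For fast driving the periodic solution exists and is unique. -/
theorem exists_existsUnique_isPeriodicSolution (hE : IsPeriodicC1 E E') (hW : IsPeriodicC1 W W')
    (z : K.Chain ℤ n) (β : ℝ) :
    ∃ τ₀ > 0, ∀ τ, τ₀ < τ → ∃! ρ, IsPeriodicSolution E W z β τ ρ := by
  obtain ⟨l, hl, k, hk, hbound⟩ := exists_energy_bound R hE hW β
  refine ⟨k / l, by positivity, fun τ hτ => ?_⟩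
  have hτ0 : 0 < τ := (div_pos hk hl).trans hτ
  have hpos : 0 < l * τ - k := by
    rw [div_lt_iff₀ hl] at hτ
    linarith
  have hzero : ∀ u : ℝ → K.Chain ℝ n, Function.Periodic u 1 →
      (∀ t, HasDerivAt u (-(τ • K.dynamicalOperator n β (E t) (W t) (u t))) t) →
      R.N *ᵥ u 0 = 0 → ∀ t, u t = 0 := by
    intro u hper hu hN t
    have h := hbound τ 0 u 0 hτ0.le hpos.le hper (by simpa using hu)
      (fun t => (N_mulVec_eq_of_hasDerivAt R hu t).trans hN) (by simp)
    funext j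
    have h1 : u t j ^ 2 ≤ 0 := by
      by_contra hcon
      exact absurd (h t j) (not_le.2 (mul_pos hpos (not_le.1 hcon)))
    exact pow_eq_zero_iff two_ne_zero |>.1 (le_antisymm h1 (sq_nonneg _))
  have hA : Continuous fun t => -(τ • dynamicalCLM n β (E t) (W t)) :=
    ((continuous_dynamicalCLM hE.continuous hW.continuous β).const_smul τ).neg
  obtain ⟨ρ, hper, hρ, hN⟩ := exists_periodic_solution hA
    (fun t => by simp only [hE.periodic t, hW.periodic t])
    (LinearMap.toContinuousLinearMap R.N.mulVecLin)
    (fun t v => by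
      change R.N *ᵥ (-(τ • K.dynamicalOperator n β (E t) (W t) v)) = 0
      rw [mulVec_neg, mulVec_smul, N_mulVec_dynamicalOperator, smul_zero, neg_zero])
    (fun u hper hu hN => hzero u hper hu hN 0) (fun j => (z j : ℝ))
  refine ⟨ρ, ⟨hρ, hper, (mem_range_boundary_iff R).2 ?_⟩, ?_⟩
  · rw [mulVec_sub, sub_eq_zero]
    exact hN
  · intro ρ' h'
    have h := hzero (ρ' - ρ) (fun t => by simp only [Pi.sub_apply, h'.periodic t, hper t])
      (fun t => by
        refine ((h'.hasDerivAt t).sub (hρ t)).congr_deriv ?_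
        change _ - -(τ • K.dynamicalOperator n β (E t) (W t) (ρ t)) = _
        rw [Pi.sub_apply, dynamicalOperator_sub, smul_sub]
        abel)
      (by
        rw [Pi.sub_apply, mulVec_sub, h'.N_mulVec R 0, sub_eq_zero]
        exact hN.symm)
    funext t
    exact sub_eq_zero.1 (h t)

theorem isPeriodicSolution_periodicSolution (h : ∃! ρ, IsPeriodicSolution E W z β τ ρ) :
    IsPeriodicSolution E W z β τ (periodicSolution E W z β τ) := by
  rw [periodicSolution, dif_pos h]
  exact h.choose_spec.1

/-! ### Curves of Gibbs weighted inverses -/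

section GibbsCurve

variable {κ ι : Type*} [Fintype κ] [DecidableEq κ] [Fintype ι] [DecidableEq ι]
  (M : Matrix κ ι ℝ) {U U' : ℝ → ι → ℝ}

theorem hasDerivAt_columnEnergy (hU : IsPeriodicC1 U U') (t : ℝ) (σ : ColumnBasis M) :
    HasDerivAt (fun t => columnEnergy M (U t) σ) (columnEnergy M (U' t) σ) t :=
  HasDerivAt.fun_sum fun i _ => (hasDerivAt_pi.1 (hU.hasDerivAt t)) (σ.1 i)

theorem continuous_columnEnergy (hU : Continuous U) (σ : ColumnBasis M) :
    Continuous fun t => columnEnergy M (U t) σ := by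
  unfold columnEnergy
  fun_prop

/-- The time derivative of `gibbsInverse M β (U t) *ᵥ b`. -/
noncomputable def gibbsInverseDeriv (β : ℝ) (u u' : ι → ℝ) : Matrix ι κ ℝ :=
  ∑ σ : ColumnBasis M, gibbsDeriv (columnMultiplicity M) β (columnEnergy M u)
    (columnEnergy M u') σ • columnInverse M σ.1

theorem isPeriodicC1_gibbsInverse_apply [Nonempty (ColumnBasis M)] (hU : IsPeriodicC1 U U')
    (β : ℝ) (α : ι) (k : κ) :
    IsPeriodicC1 (fun t => gibbsInverse M β (U t) α k)
      (fun t => gibbsInverseDeriv M β (U t) (U' t) α k) := by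
  have h1 : ∀ t, gibbsInverse M β (U t) α k = ∑ σ : ColumnBasis M,
      gibbs (columnMultiplicity M) β (columnEnergy M (U t)) σ * columnInverse M σ.1 α k :=
    fun t => by simp [gibbsInverse, Matrix.sum_apply]
  have h2 : ∀ t, gibbsInverseDeriv M β (U t) (U' t) α k = ∑ σ : ColumnBasis M,
      gibbsDeriv (columnMultiplicity M) β (columnEnergy M (U t)) (columnEnergy M (U' t)) σ *
        columnInverse M σ.1 α k :=
    fun t => by simp [gibbsInverseDeriv, Matrix.sum_apply]
  refine ⟨fun t => ?_, ?_, fun t => ?_, fun t => ?_⟩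
  · simp only [h1, h2]
    exact HasDerivAt.fun_sum fun σ _ => (HasDerivAt.gibbs (columnMultiplicity_pos M)
      (hasDerivAt_columnEnergy M hU t) σ).mul_const _
  · simp only [h2]
    exact continuous_finsetSum _ fun σ _ => (continuous_gibbsDeriv (columnMultiplicity_pos M)
      (hasDerivAt_columnEnergy M hU) (continuous_columnEnergy M hU.continuous_deriv)
      β σ).mul_const _
  · simp only [hU.periodic t]
  · simp only [hU.periodic t, hU.periodic_deriv t]

theorem isPeriodicC1_gibbsInverse_mulVec [Nonempty (ColumnBasis M)] (hU : IsPeriodicC1 U U')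
    (β : ℝ) (b : κ → ℝ) :
    IsPeriodicC1 (fun t => gibbsInverse M β (U t) *ᵥ b)
      (fun t => gibbsInverseDeriv M β (U t) (U' t) *ᵥ b) where
  hasDerivAt t := hasDerivAt_pi.2 fun α => HasDerivAt.fun_sum fun k _ =>
    ((isPeriodicC1_gibbsInverse_apply M hU β α k).hasDerivAt t).mul_const _
  continuous_deriv := continuous_pi fun α => continuous_finsetSum _ fun k _ =>
    (isPeriodicC1_gibbsInverse_apply M hU β α k).continuous_deriv.mul_const _
  periodic t := by simp only [hU.periodic t]
  periodic_deriv t := by simp only [hU.periodic t, hU.periodic_deriv t]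

end GibbsCurve

/-! ### The average current in the adiabatic limit -/

/-- The time derivative of the Boltzmann distribution. -/
noncomputable def boltzmannDeriv (β : ℝ) (e e' : K.cell n → ℝ) (z : K.Chain ℝ n) : K.Chain ℝ n :=
  gibbsInverseDeriv R.N β e e' *ᵥ (R.N *ᵥ z)

theorem isPeriodicC1_boltzmann (hE : IsPeriodicC1 E E') (β : ℝ) (z : K.Chain ℝ n) :
    IsPeriodicC1 (fun t => boltzmann R β (E t) z) (fun t => boltzmannDeriv R β (E t) (E' t) z) :=
  have := nonempty_columnBasis_N R
  isPeriodicC1_gibbsInverse_mulVec R.N hE β _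

/-- **Adiabatic theorem.** For fast driving the periodic solution is uniformly close to the
Boltzmann distribution. -/
theorem exists_abs_sub_boltzmann_le (hE : IsPeriodicC1 E E') (hW : IsPeriodicC1 W W')
    (z : K.Chain ℤ n) (β : ℝ) :
    ∃ b : ℝ → ℝ, Tendsto b atTop (𝓝 0) ∧ ∀ᶠ τ in atTop, ∀ ρ, IsPeriodicSolution E W z β τ ρ →
      ∀ t j, |ρ t j - boltzmann R β (E t) (fun j => (z j : ℝ)) j| ≤ b τ := by
  obtain ⟨l, hl, k, hk, hbound⟩ := exists_energy_bound R hE hW β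
  set ρB := fun t => boltzmann R β (E t) (fun j => (z j : ℝ)) with hρB
  set ρB' := fun t => boltzmannDeriv R β (E t) (E' t) (fun j => (z j : ℝ)) with hρB'
  have hB : IsPeriodicC1 ρB ρB' := isPeriodicC1_boltzmann R hE β _
  obtain ⟨G, hG0, hG⟩ := exists_norm_le_of_periodic
    (f := fun t => ∑ j, Real.exp (β * E t j) * ρB' t j ^ 2)
    (by
      have h1 := hE.continuous
      have h2 := hB.continuous_deriv
      fun_prop)
    (fun t => by simp only [hE.periodic t, hB.periodic_deriv t])
  have hlin : Tendsto (fun τ => l * τ - k) atTop atTop :=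
    tendsto_atTop_add_const_right _ _ (tendsto_id.const_mul_atTop hl)
  refine ⟨fun τ => √(G / (l * τ - k)), ?_, ?_⟩
  · have := (hlin.const_div_atTop G).sqrt
    rwa [Real.sqrt_zero] at this
  · filter_upwards [eventually_ge_atTop 0, hlin.eventually_gt_atTop 0] with τ hτ hpos ρ hρ t j
    have h := hbound τ G (fun t => ρ t - ρB t) ρB' hτ hpos.le
      (fun t => by simp only [hρ.periodic t, hB.periodic t])
      (fun t => by
        refine ((hρ.hasDerivAt t).sub (hB.hasDerivAt t)).congr_deriv ?_
        rw [dynamicalOperator_sub, hρB, dynamicalOperator_boltzmann, sub_zero])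
      (fun t => by rw [mulVec_sub, hρ.N_mulVec R, hρB, N_mulVec_boltzmann, sub_self])
      (fun t => (le_abs_self _).trans (hG t)) t j
    refine Real.abs_le_sqrt ?_
    rw [le_div_iff₀ hpos, mul_comm]
    exact h

variable [DecidableEq (K.cell (n + 1))]

/-- The current is determined by the change of the density: it is the flow of least weight with
boundary `-ρ'`. -/
theorem IsPeriodicSolution.smul_biasedCoboundary_eq (h : IsPeriodicSolution E W z β τ ρ) (t : ℝ) :
    τ • K.biasedCoboundary n β (E t) (W t) (ρ t) =
      -(gibbsInverse R.D β (W t) *ᵥ (R.φ *ᵥ deriv ρ t)) := by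
  have := nonempty_columnBasis_D R
  rw [(h.hasDerivAt t).deriv, mulVec_neg, mulVec_neg, neg_neg]
  refine eq_of_mulVec_eq_of_orthogonal R.D (w := fun α => Real.exp (-(β * W t α)))
    (fun α => Real.exp_pos _) ?_ ?_ ?_
  · rw [mulVec_mulVec _ R.D, mul_gibbsInverse, one_mulVec, mulVec_smul, mulVec_smul,
      dynamicalOperator, boundary_eq_mulVec, R.φ_mulVec_mulVec]
  · intro y hy
    rw [R.D_mulVec_eq_zero_iff, ← boundary_eq_mulVec] at hy
    have h1 := biasedCoboundary_orthogonal β (E t) (W t) (ρ t) hy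
    rw [← mul_zero τ, ← h1, Finset.mul_sum]
    refine Finset.sum_congr rfl fun α _ => ?_
    rw [Pi.smul_apply, smul_eq_mul]
    ring
  · intro y hy
    exact gibbsInverse_orthogonal R.D β (W t) hy _

theorem continuous_currentDensity (hE : Continuous E) (hW : Continuous W)
    (h : ∃! ρ, IsPeriodicSolution E W z β τ ρ) : Continuous (currentDensity E W z β τ) :=
  (continuous_biasedCoboundary hE hW (isPeriodicSolution_periodicSolution h).continuous
    β).const_smul τ

theorem averageCurrent_apply (hE : Continuous E) (hW : Continuous W)
    (h : ∃! ρ, IsPeriodicSolution E W z β τ ρ) (α : K.cell (n + 1)) :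
    averageCurrent E W z β τ α = ∫ t in (0 : ℝ)..1, currentDensity E W z β τ t α :=
  ((ContinuousLinearMap.proj (R := ℝ) (φ := fun _ : K.cell (n + 1) => ℝ)
    α).intervalIntegral_comp_comm
    ((continuous_currentDensity hE hW h).intervalIntegrable _ _)).symm

theorem boundary_averageCurrent (hE : Continuous E) (hW : Continuous W)
    (h : ∃! ρ, IsPeriodicSolution E W z β τ ρ) :
    K.boundary ℝ n (averageCurrent E W z β τ) = 0 := by
  have hρ := isPeriodicSolution_periodicSolution h
  have hc := continuous_currentDensity hE hW h
  have h1 := (LinearMap.toContinuousLinearMap (K.boundary ℝ n)).intervalIntegral_comp_comm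
    (hc.intervalIntegrable (μ := MeasureTheory.volume) 0 1)
  refine h1.symm.trans ?_
  have hderiv : ∀ t ∈ Set.uIcc (0 : ℝ) 1, HasDerivAt (fun t => -periodicSolution E W z β τ t)
      (LinearMap.toContinuousLinearMap (K.boundary ℝ n) (currentDensity E W z β τ t)) t := by
    intro t _
    refine (hρ.hasDerivAt t).neg.congr_deriv ?_
    rw [neg_neg]
    exact (map_smul (K.boundary ℝ n) τ _).symm
  rw [intervalIntegral.integral_eq_sub_of_hasDerivAt hderiv
    (((LinearMap.toContinuousLinearMap (K.boundary ℝ n)).continuous.comp hc).intervalIntegrable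
      _ _)]
  have := hρ.periodic 0
  rw [zero_add] at this
  simp [this]

/-- The average current in the adiabatic limit. -/
noncomputable def adiabaticCurrent (E E' : ℝ → K.cell n → ℝ) (W : ℝ → K.cell (n + 1) → ℝ)
    (z : K.Chain ℝ n) (β : ℝ) : K.Chain ℝ (n + 1) := fun α =>
  -∫ t in (0 : ℝ)..1, ∑ i, gibbsInverse R.D β (W t) α i *
    (R.φ *ᵥ boltzmannDeriv R β (E t) (E' t) z) i

/-- The average current converges in the adiabatic limit: after an integration by parts it
depends on the density, and no longer on its derivative. -/
theorem tendsto_averageCurrent (hE : IsPeriodicC1 E E') (hW : IsPeriodicC1 W W')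
    (z : K.Chain ℤ n) (β : ℝ) :
    Tendsto (fun τ => averageCurrent E W z β τ) atTop
      (𝓝 (adiabaticCurrent R E E' W (fun j => (z j : ℝ)) β)) := by
  have := nonempty_columnBasis_D R
  refine tendsto_pi_nhds.2 fun α => ?_
  obtain ⟨τ₀, -, hτ₀⟩ := exists_existsUnique_isPeriodicSolution R hE hW z β
  obtain ⟨b, hb, hbound⟩ := exists_abs_sub_boltzmann_le R hE hW z β
  set ρB := fun t => boltzmann R β (E t) (fun j => (z j : ℝ)) with hρB
  set ρB' := fun t => boltzmannDeriv R β (E t) (E' t) (fun j => (z j : ℝ)) with hρB'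
  have hB : IsPeriodicC1 ρB ρB' := isPeriodicC1_boltzmann R hE β _
  set a := fun t i => gibbsInverse R.D β (W t) α i with ha
  set a' := fun t i => gibbsInverseDeriv R.D β (W t) (W' t) α i with ha'
  have haC : ∀ i, IsPeriodicC1 (fun t => a t i) (fun t => a' t i) := fun i =>
    isPeriodicC1_gibbsInverse_apply R.D hW β α i
  choose Ka hKa0 hKa using fun i =>
    exists_norm_le_of_periodic (haC i).continuous_deriv (haC i).periodic_deriv
  rw [tendsto_iff_norm_sub_tendsto_zero]
  have hlim : Tendsto (fun τ => ∑ i, Ka i * ((∑ j, |R.φ i j|) * b τ)) atTop (𝓝 0) := by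
    have : Tendsto (fun τ => ∑ i, Ka i * ((∑ j, |R.φ i j|) * b τ)) atTop
        (𝓝 (∑ i, Ka i * ((∑ j, |R.φ i j|) * 0))) :=
      tendsto_finsetSum _ fun i _ => (hb.const_mul _).const_mul _
    simpa using this
  refine squeeze_zero' (Eventually.of_forall fun _ => norm_nonneg _) ?_ hlim
  filter_upwards [eventually_gt_atTop τ₀, hbound] with τ hτ hρb
  have hex := hτ₀ τ hτ
  set ρ := periodicSolution E W z β τ with hρdef
  have hρ : IsPeriodicSolution E W z β τ ρ := isPeriodicSolution_periodicSolution hex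
  set ξ : ℝ → Fin R.r → ℝ := fun t => R.φ *ᵥ (ρ t - ρB t) with hξ
  set ξ' : ℝ → Fin R.r → ℝ := fun t => R.φ *ᵥ (deriv ρ t - ρB' t) with hξ'
  have hdρ : deriv ρ = fun t => -(τ • K.dynamicalOperator n β (E t) (W t) (ρ t)) :=
    funext fun t => (hρ.hasDerivAt t).deriv
  have hcdρ : Continuous (deriv ρ) := by
    rw [hdρ]
    have := (continuous_dynamicalCLM hE.continuous hW.continuous β).clm_apply hρ.continuous
    exact (this.const_smul τ).neg
  have hmul : ∀ {f : ℝ → K.Chain ℝ n}, Continuous f → ∀ i, Continuous fun t => (R.φ *ᵥ f t) i :=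
    fun {f} hf i => by
      simp only [mulVec, dotProduct]
      fun_prop
  have hξd : ∀ t i, HasDerivAt (fun t => ξ t i) (ξ' t i) t := fun t i =>
    (hasDerivAt_pi.1 (hasDerivAt_mulVec R.φ
      ((hρ.hasDerivAt t).differentiableAt.hasDerivAt.sub (hB.hasDerivAt t)))) i
  have hξc : ∀ i, Continuous fun t => ξ' t i := hmul (hcdρ.sub hB.continuous_deriv)
  have hξper : ∀ i, ξ 1 i = ξ 0 i := by
    intro i
    have h1 := hρ.periodic 0
    have h2 := hB.periodic 0
    rw [zero_add] at h1 h2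
    simp only [hξ, h1, h2]
  have haper : ∀ i, a 1 i = a 0 i := by
    intro i
    have := (haC i).periodic 0
    rwa [zero_add] at this
  -- The difference of the two currents, integrated by parts.
  have hdiff : averageCurrent E W z β τ α - adiabaticCurrent R E E' W (fun j => (z j : ℝ)) β α =
      ∑ i, ∫ t in (0 : ℝ)..1, a' t i * ξ t i := by
    have h1 : averageCurrent E W z β τ α =
        -∫ t in (0 : ℝ)..1, ∑ i, a t i * (R.φ *ᵥ deriv ρ t) i := by
      rw [averageCurrent_apply hE.continuous hW.continuous hex, ← intervalIntegral.integral_neg]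
      refine intervalIntegral.integral_congr fun t _ => ?_
      exact congrFun (hρ.smul_biasedCoboundary_eq R t) α
    have hint1 : Continuous fun t => ∑ i, a t i * (R.φ *ᵥ deriv ρ t) i :=
      continuous_finsetSum _ fun i _ => (haC i).continuous.mul (hmul hcdρ i)
    have hint2 : Continuous fun t => ∑ i, a t i * (R.φ *ᵥ ρB' t) i :=
      continuous_finsetSum _ fun i _ => (haC i).continuous.mul (hmul hB.continuous_deriv i)
    have h2 : averageCurrent E W z β τ α -
        adiabaticCurrent R E E' W (fun j => (z j : ℝ)) β α =
        -∫ t in (0 : ℝ)..1, ∑ i, a t i * ξ' t i := by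
      rw [h1, adiabaticCurrent, ← neg_add', ← sub_eq_add_neg,
        ← intervalIntegral.integral_sub (hint1.intervalIntegrable _ _)
          (hint2.intervalIntegrable _ _)]
      congr 1
      refine intervalIntegral.integral_congr fun t _ => ?_
      simp only [hξ', mulVec_sub, Pi.sub_apply, mul_sub, Finset.sum_sub_distrib]
    have hint : ∀ i, Continuous fun t => a t i * ξ' t i := fun i =>
      (haC i).continuous.mul (hξc i)
    rw [h2, intervalIntegral.integral_finsetSum fun i _ => (hint i).intervalIntegrable _ _,
      ← Finset.sum_neg_distrib]
    refine Finset.sum_congr rfl fun i _ => ?_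
    rw [intervalIntegral.integral_mul_deriv_eq_deriv_mul (fun t _ => (haC i).hasDerivAt t)
      (fun t _ => hξd t i) ((haC i).continuous_deriv.intervalIntegrable _ _)
      ((hξc i).intervalIntegrable _ _), haper, hξper, sub_self, zero_sub, neg_neg]
  rw [hdiff]
  refine (norm_sum_le _ _).trans (Finset.sum_le_sum fun i _ => ?_)
  have hξb : ∀ t, |ξ t i| ≤ (∑ j, |R.φ i j|) * b τ := by
    intro t
    rw [Finset.sum_mul]
    refine (Finset.abs_sum_le_sum_abs _ _).trans (Finset.sum_le_sum fun j _ => ?_)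
    rw [abs_mul]
    exact mul_le_mul_of_nonneg_left (hρb ρ hρ t j) (abs_nonneg _)
  have h3 := intervalIntegral.norm_integral_le_of_norm_le_const (a := 0) (b := 1)
    (f := fun t => a' t i * ξ t i) (C := Ka i * ((∑ j, |R.φ i j|) * b τ)) (fun t _ => by
      rw [norm_mul]
      exact mul_le_mul (hKa i t) (hξb t) (norm_nonneg _) (hKa0 i))
  simpa using h3

end BasedComplex

/-! ### Quantization at zero temperature -/

namespace BasedComplex

open Matrix

variable {K : BasedComplex.{u}} {n : ℕ} [DecidableEq (K.cell n)] [DecidableEq (K.cell (n + 1))]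

/-- The factorization of the real boundary matrix that comes from a rational one. -/
noncomputable abbrev realFactorization (R : RankFactorization (K.boundaryMatrix ℚ n)) :
    RankFactorization (K.boundaryMatrix ℝ n) :=
  R.map (algebraMap ℚ ℝ) (K.boundaryMatrix_map ℚ (algebraMap ℚ ℝ) n)

theorem det_submatrix_ne_zero_of_map {κ ι : Type*} [Fintype κ] [DecidableEq κ]
    {M : Matrix κ ι ℚ} {σ : κ → ι} (h : ((M.map (algebraMap ℚ ℝ)).submatrix id σ).det ≠ 0) :
    (M.submatrix id σ).det ≠ 0 := by
  intro h0
  have h1 := RingHom.map_det (algebraMap ℚ ℝ) (M.submatrix id σ)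
  rw [h0, map_zero] at h1
  exact h h1.symm

/-- The building blocks of the quantized current: move the cycle `z` to a chain on a spanning
co-tree `L`, and fill the difference by a chain on a spanning tree `T`. The first step has
denominator `a_L` and the second has denominator `θ_T`. -/
theorem columnInverse_sub_mem_adjoin (R : RankFactorization (K.boundaryMatrix ℚ n))
    {z : K.Chain ℤ n} (hz : K.bdry ℤ n z = 0) (σ : ColumnBasis (realFactorization R).D)
    (ν : ColumnBasis (realFactorization R).N) (α : K.cell (n + 1)) :
    (columnInverse (realFactorization R).D σ.1 *ᵥ ((realFactorization R).φ *ᵥ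
      (columnInverse (realFactorization R).N ν.1 *ᵥ
        ((realFactorization R).N *ᵥ fun j => (z j : ℝ)) - fun j => (z j : ℝ)))) α ∈
      Algebra.adjoin ℤ {((K.delta n : ℝ))⁻¹} := by
  have hσ : (R.D.submatrix id σ.1).det ≠ 0 := det_submatrix_ne_zero_of_map σ.2
  have hν : (R.N.submatrix id ν.1).det ≠ 0 := det_submatrix_ne_zero_of_map ν.2
  have hT := isSpanningTree_image R hσ
  have hL := isSpanningCotree_image R hν
  set T : Finset (K.cell (n + 1)) := Finset.univ.image σ.1 with hTdef
  set L : Finset (K.cell n) := Finset.univ.image ν.1 with hLdef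
  set a := K.cotreeIndex n L with ha
  set θ := K.treeTorsion n T with hθ
  have ha0 : (a : ℝ) ≠ 0 := Nat.cast_ne_zero.2 hL.cotreeIndex_pos.ne'
  have hθ0 : (θ : ℝ) ≠ 0 := Nat.cast_ne_zero.2 (K.treeTorsion_pos T).ne'
  obtain ⟨l, hl, x, hx⟩ := exists_cotreeIndex_smul_eq L hz
  obtain ⟨y, hy, hyx⟩ := exists_boundary_eq_treeTorsion_smul R hσ x
  set zR : K.Chain ℝ n := fun j => (z j : ℝ) with hzR
  set lR : K.Chain ℝ n := fun j => (l j : ℝ) with hlR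
  set xR : K.Chain ℝ (n + 1) := fun j => (x j : ℝ) with hxR
  set yR : K.Chain ℝ (n + 1) := fun j => (y j : ℝ) with hyR
  have hxR' : (a : ℝ) • zR = lR + K.boundary ℝ n xR := by
    rw [hxR, boundary_cast]
    funext j
    have h := congrFun hx j
    simp only [Pi.smul_apply, Pi.add_apply, nsmul_eq_mul, smul_eq_mul, hzR, hlR] at h ⊢
    exact_mod_cast h
  have hyR' : K.boundary ℝ n yR = (θ : ℝ) • K.boundary ℝ n xR := by
    rw [hxR, hyR, boundary_cast, boundary_cast]
    funext j
    have h := congrFun hyx j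
    simp only [Pi.smul_apply, nsmul_eq_mul, smul_eq_mul] at h ⊢
    exact_mod_cast h
  have h1 : columnInverse (realFactorization R).N ν.1 *ᵥ ((realFactorization R).N *ᵥ zR) =
      (a : ℝ)⁻¹ • lR := by
    have h2 : zR = (a : ℝ)⁻¹ • (lR + K.boundary ℝ n xR) := by rw [← hxR', inv_smul_smul₀ ha0]
    rw [h2, boundary_eq_mulVec, mulVec_smul, mulVec_add,
      (realFactorization R).N_mulVec_mulVec, add_zero, mulVec_smul,
      columnInverse_mulVec_of_mem_chainsOn ν.2 (cast_mem_chainsOn hl)]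
  have h2 : (a : ℝ)⁻¹ • lR - zR = -((a : ℝ)⁻¹ * (θ : ℝ)⁻¹) • K.boundary ℝ n yR := by
    have h3 : lR = (a : ℝ) • zR - K.boundary ℝ n xR := by rw [hxR', add_sub_cancel_right]
    rw [h3, smul_sub, inv_smul_smul₀ ha0, hyR', smul_smul, neg_mul, mul_assoc,
      inv_mul_cancel₀ hθ0, mul_one, neg_smul]
    abel
  rw [h1, h2, boundary_eq_mulVec, mulVec_smul, (realFactorization R).φ_mulVec_mulVec,
    mulVec_smul,
    columnInverse_mulVec_of_mem_chainsOn σ.2 (cast_mem_chainsOn hy), Pi.smul_apply, smul_eq_mul]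
  obtain ⟨k, hk⟩ := dvd_delta hL hT
  have hδ : (a : ℝ)⁻¹ * (θ : ℝ)⁻¹ = (k : ℝ) * (K.delta n : ℝ)⁻¹ := by
    have hk0 : (k : ℝ) ≠ 0 := by
      rintro h0
      have := K.delta_pos n
      rw [hk, Nat.cast_eq_zero.1 h0, mul_zero] at this
      exact lt_irrefl _ this
    rw [hk, ← ha, ← hθ]
    push_cast
    field_simp
  rw [hδ]
  refine mul_mem (neg_mem (mul_mem (natCast_mem _ k) (Algebra.subset_adjoin rfl))) ?_
  exact intCast_mem _ (y α)

theorem adiabaticCurrent_apply (R : RankFactorization (K.boundaryMatrix ℝ n))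
    (E E' : ℝ → K.cell n → ℝ) (W : ℝ → K.cell (n + 1) → ℝ) (z : K.Chain ℝ n) (β : ℝ)
    (α : K.cell (n + 1)) :
    adiabaticCurrent R E E' W z β α = ∫ t in (0 : ℝ)..1, ∑ σ : ColumnBasis R.D,
      ∑ ν : ColumnBasis R.N,
        -(columnInverse R.D σ.1 *ᵥ (R.φ *ᵥ (columnInverse R.N ν.1 *ᵥ (R.N *ᵥ z) - z))) α *
        (gibbs (columnMultiplicity R.D) β (columnEnergy R.D (W t)) σ *
          gibbsDeriv (columnMultiplicity R.N) β (columnEnergy R.N (E t))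
            (columnEnergy R.N (E' t)) ν) := by
  have := nonempty_columnBasis_N R
  rw [adiabaticCurrent, ← intervalIntegral.integral_neg]
  refine intervalIntegral.integral_congr fun t _ => ?_
  set q' := gibbsDeriv (columnMultiplicity R.N) β (columnEnergy R.N (E t))
    (columnEnergy R.N (E' t)) with hq'
  -- The probabilities have constant sum, so `z` can be subtracted from all the states.
  have h1 : boltzmannDeriv R β (E t) (E' t) z =
      ∑ ν, q' ν • (columnInverse R.N ν.1 *ᵥ (R.N *ᵥ z) - z) := by
    simp only [smul_sub, Finset.sum_sub_distrib, ← Finset.sum_smul]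
    rw [hq', sum_gibbsDeriv (columnMultiplicity_pos R.N), zero_smul, sub_zero, boltzmannDeriv,
      gibbsInverseDeriv, sum_mulVec]
    exact Finset.sum_congr rfl fun ν _ => smul_mulVec _ _ _
  change -(gibbsInverse R.D β (W t) *ᵥ (R.φ *ᵥ boltzmannDeriv R β (E t) (E' t) z)) α = _
  rw [gibbsInverse_mulVec_apply, h1, ← Finset.sum_neg_distrib]
  refine Finset.sum_congr rfl fun σ _ => ?_
  rw [mulVec_sum, mulVec_sum, Finset.sum_apply, Finset.mul_sum, ← Finset.sum_neg_distrib]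
  refine Finset.sum_congr rfl fun ν _ => ?_
  rw [mulVec_smul, mulVec_smul, Pi.smul_apply, smul_eq_mul]
  ring

/-- The adiabatic current of a good loop converges at zero temperature to a chain with
coefficients in `ℤ[1/δ]`. -/
theorem exists_tendsto_adiabaticCurrent (R : RankFactorization (K.boundaryMatrix ℚ n))
    {E E' : ℝ → K.cell n → ℝ} {W W' : ℝ → K.cell (n + 1) → ℝ}
    (hE : IsPeriodicC1 E E') (hW : IsPeriodicC1 W W')
    (hgood : ∀ t, Function.Injective (E t) ∨ Function.Injective (W t))
    {z : K.Chain ℤ n} (hz : K.bdry ℤ n z = 0) (α : K.cell (n + 1)) :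
    ∃ l ∈ Algebra.adjoin ℤ {((K.delta n : ℝ))⁻¹},
      Tendsto (fun β => adiabaticCurrent (realFactorization R) E E' W (fun j => (z j : ℝ)) β α)
        atTop (𝓝 l) := by
  set R' := realFactorization R with hR'
  have := nonempty_columnBasis_N R'
  have := nonempty_columnBasis_D R'
  simp only [adiabaticCurrent_apply]
  have hbound : ∀ {κ ι : Type _} [Fintype κ] [DecidableEq κ] [Fintype ι] [DecidableEq ι]
      (M : Matrix κ ι ℝ) {U' : ℝ → ι → ℝ}, Continuous U' → Function.Periodic U' 1 →
      ∃ C, 0 ≤ C ∧ ∀ t (σ : ColumnBasis M), |columnEnergy M (U' t) σ| ≤ C := by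
    intro κ ι _ _ _ _ M U' hU hper
    exact exists_abs_le_of_periodic
      (f := fun t (σ : ColumnBasis M) => columnEnergy M (U' t) σ)
      (continuous_pi fun σ => continuous_columnEnergy M hU σ) fun t => by simp only [hper t]
  obtain ⟨CE, hCE0, hCE⟩ := hbound R'.N hE.continuous_deriv hE.periodic_deriv
  obtain ⟨CW, hCW0, hCW⟩ := hbound R'.D hW.continuous_deriv hW.periodic_deriv
  have hE1 : E 1 = E 0 := by simpa using hE.periodic 0
  have hW1 : W 1 = W 0 := by simpa using hW.periodic 0
  refine exists_tendsto_integral_gibbs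
    (Λ := (Algebra.adjoin ℤ {((K.delta n : ℝ))⁻¹}).toSubring.toAddSubgroup)
    (columnMultiplicity_pos R'.D) (columnMultiplicity_pos R'.N)
    (hasDerivAt_columnEnergy R'.D hW) (continuous_columnEnergy R'.D hW.continuous_deriv)
    (hasDerivAt_columnEnergy R'.N hE) (continuous_columnEnergy R'.N hE.continuous_deriv)
    (K := CE + CW) (fun t σ => (hCW t σ).trans (by linarith))
    (fun t σ => (hCE t σ).trans (by linarith)) (by rw [hW1]) (by rw [hE1])
    (C := fun (σ : ColumnBasis R'.D) (ν : ColumnBasis R'.N) => -(columnInverse R'.D σ.1 *ᵥ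
      (R'.φ *ᵥ (columnInverse R'.N ν.1 *ᵥ (R'.N *ᵥ fun j => (z j : ℝ)) -
        fun j => (z j : ℝ)))) α)
    (fun σ ν => neg_mem (columnInverse_sub_mem_adjoin R hz σ ν α)) fun t => ?_
  rcases hgood t with h | h
  · right
    obtain ⟨ν₀, hν₀⟩ := exists_least_columnBasis (exists_det_submatrix_ne_zero R'.mul_Y) h
    exact ⟨ν₀, fun ν => (hν₀ ν).imp_left fun h σ => by rw [h]⟩
  · left
    obtain ⟨σ₀, hσ₀⟩ := exists_least_columnBasis (exists_det_submatrix_ne_zero R'.mul_X) h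
    exact ⟨σ₀, fun σ => (hσ₀ σ).imp_left fun h => by rw [h]⟩

end BasedComplex

theorem theoremC {X : Type u} [TopologicalSpace X] [T2Space X] [ConnectedSpace X]
    [Topology.CWComplex (Set.univ : Set X)] [Topology.CWComplex.Finite (Set.univ : Set X)]
    (n : ℕ) (hdim : ∀ m, n + 1 < m → IsEmpty (CellularChains.Cell X m))
    (hdim' : Nonempty (CellularChains.Cell X (n + 1)))
    (o : CellularChains.Orientation X)
    (z : o.complex.Chain ℤ n) (hz : o.complex.bdry ℤ n z = 0)
    (E : ℝ → o.complex.cell n → ℝ) (W : ℝ → o.complex.cell (n + 1) → ℝ)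
    (hE : ContDiff ℝ ∞ E) (hW : ContDiff ℝ ∞ W)
    (hEper : Function.Periodic E 1) (hWper : Function.Periodic W 1)
    (hgood : ∀ t, Function.Injective (E t) ∨ Function.Injective (W t)) :
    (∀ β : ℝ, 0 < β → ∃ τ₀ : ℝ, 0 < τ₀ ∧ ∀ τ : ℝ, τ₀ < τ →
      (∃! ρ, BasedComplex.IsPeriodicSolution E W z β τ ρ) ∧
      o.complex.boundary ℝ n (BasedComplex.averageCurrent E W z β τ) = 0) ∧
    0 < o.complex.delta n ∧
    ∃ (QB : ℝ → o.complex.Chain ℝ (n + 1)) (Q : o.complex.Chain ℝ (n + 1)),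
      (∀ β : ℝ, 0 < β →
        Tendsto (fun τ => BasedComplex.averageCurrent E W z β τ) atTop (𝓝 (QB β))) ∧
      Tendsto QB atTop (𝓝 Q) ∧
      o.complex.boundary ℝ n Q = 0 ∧
      ∀ α, Q α ∈ Algebra.adjoin ℤ {((o.complex.delta n : ℝ))⁻¹} := by
  classical
  obtain ⟨R⟩ := Matrix.RankFactorization.exists_rankFactorization (o.complex.boundaryMatrix ℚ n)
  have hE' := hE.isPeriodicC1 hEper
  have hW' := hW.isPeriodicC1 hWper
  have hex := BasedComplex.exists_existsUnique_isPeriodicSolution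
    (BasedComplex.realFactorization R) hE' hW' z
  choose Q hQ hQlim using BasedComplex.exists_tendsto_adiabaticCurrent R hE' hW' hgood hz
  have hcont : Continuous (o.complex.boundary ℝ n) := LinearMap.continuous_of_finiteDimensional _
  have hQB := BasedComplex.tendsto_averageCurrent (BasedComplex.realFactorization R) hE' hW' z
  refine ⟨fun β _ => ?_, o.complex.delta_pos n, _, Q, fun β _ => hQB β,
    tendsto_pi_nhds.2 hQlim, ?_, hQ⟩
  · obtain ⟨τ₀, h0, h⟩ := hex β
    exact ⟨τ₀, h0, fun τ hτ => ⟨h τ hτ,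
      BasedComplex.boundary_averageCurrent hE'.continuous hW'.continuous (h τ hτ)⟩⟩
  · have hB : ∀ β, o.complex.boundary ℝ n (BasedComplex.adiabaticCurrent
        (BasedComplex.realFactorization R) E (deriv E) W (fun j => (z j : ℝ)) β) = 0 := by
      intro β
      refine tendsto_nhds_unique ((hcont.tendsto _).comp (hQB β))
        (tendsto_const_nhds.congr' ?_)
      obtain ⟨τ₀, -, h⟩ := hex β
      filter_upwards [eventually_gt_atTop τ₀] with τ hτ
      exact (BasedComplex.boundary_averageCurrent hE'.continuous hW'.continuous (h τ hτ)).symm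
    exact tendsto_nhds_unique ((hcont.tendsto _).comp (tendsto_pi_nhds.2 hQlim))
      (tendsto_const_nhds.congr fun β => (hB β).symm)
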